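/- Let $M$ and $N$ be smooth Riemannian manifolds of dimension $n$ (Hausdorff, second countable, without boundary), with Riemannian distances $d_M,d_N$ and Riemannian volume measures $\mathrm{vol}_M,\mathrm{vol}_N$ (given by $\sqrt{\det(g_{ij})}\,dx^1\cdots dx^n$ in local coordinates). Let $x_0\in M$ and let $0<\delta<\operatorname{inj}(M)$, where $\operatorname{inj}(M)$ is the injectivity radius. Let $k=k(x_0,\cdot):M\to\mathbb R$ vanish outside the closed ball $\{y: d_M(x_0,y)\le\delta\}$. For $x\in M$ and a geodesic $\gamma:[0,1]\to M$ from $x_0$ to $x$, let $\mathrm{PT}_{x_0}^{x}:T_{x_0}M\to T_xM$ be the Levi-Civita parallel transport along $\gamma$, let $\exp_x^{-1}$ be the inverse of $\exp_x$ restricted to $\{v\in T_xM:|v|\le\delta\}$, and put $$k_\gamma(x,y)=k\bigl(x_0,\ \exp_{x_0}\circ(\mathrm{PT}_{x_0}^{x})^{-1}\circ\exp_x^{-1}(y)\bigr)\ \text{ if } d_M(x,y)\le\delta,\qquad k_\gamma(x,y)=0\ \text{ otherwise.}$$ The parallel transport convolution of $f:M\to\mathbb R$ with $k$ at $x$, along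 $\gamma$, is $$(f*_M k)_\gamma(x)=\int_M f(y)\,k_\gamma(x,y)\,d\mathrm{vol}_M(y).$$ **Theorem.** Let $\Phi:M\to N$ be an isometry, i.e. a diffeomorphism that preserves the Riemannian metrics. Then parallel transport convolution is invariant under $\Phi$. Precisely: 1. $\delta<\operatorname{inj}(N)$, the function $k\circ\Phi^{-1}$ vanishes outside the closed ball of radius $\delta$ around $\Phi(x_0)$, and $\Phi_*\mathrm{vol}_M=\mathrm{vol}_N$. 2. For every $x\in M$ and every geodesic $\gamma$ from $x_0$ to $x$, the curve $\Phi\circ\gamma$ is a geodesic from $\Phi(x_0)$ to $\Phi(x)$, minimizing if $\gamma$ is; for $v\in T_{x_0}M$ and $w\in T_xM$, $w$ is the parallel transport of $v$ along $\gamma$ if and only if $d\Phi_x(w)$ is the parallel transport of $d\Phi_{x_0}(v)$ along $\Phi\circ\gamma$; and $$\bigl((f\circ\Phi^{-1})*_N(k\circ\Phi^{-1})\bigr)_{\Phi\circ\gamma}(\Phi(x))=(f*_M k)_\gamma(x)\qquad\text{for every } f:M\to\mathbb R,$$ where the integrand on one side is integrable if and only if the integrand on the other side is (if they are not integrable, both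 integrals are read as $0$). 3. In particular, if the minimizing geodesic $\gamma$ from $x_0$ to $x$ is unique, then $$\bigl((f\circ\Phi^{-1})*_N(k\circ\Phi^{-1})\bigr)_{\gamma'}(\Phi(x))=(f*_M k)_\gamma(x)$$ for every minimizing geodesic $\gamma'$ from $\Phi(x_0)$ to $\Phi(x)$. -/

import Mathlib

open Set MeasureTheory Manifold Bundle
open scoped ContDiff ENNReal

noncomputable section

namespace PTC

/-- Coordinate space of an `n`-dimensional manifold. -/
abbrev Coord (n : ℕ) : Type := EuclideanSpace ℝ (Fin n)

/-- The `i`-th standard basis vector of the coordinate space. -/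
def stdVec (n : ℕ) (i : Fin n) : Coord n := EuclideanSpace.single i (1 : ℝ)

section Metric

variable {n : ℕ} {M : Type*} [TopologicalSpace M] [ChartedSpace (Coord n) M]
  [RiemannianBundle (fun x : M ↦ TangentSpace (𝓡 n) x)]

/-- The matrix `g_ij(y) = ⟨∂_i, ∂_j⟩` of the Riemannian metric in the chart `e`, as a function of
the coordinates `y ∈ e.target`; here `∂_i = d(e⁻¹)_y (stdVec i)`. -/
def metricMatrix (e : OpenPartialHomeomorph M (Coord n)) (y : Coord n) :
    Matrix (Fin n) (Fin n) ℝ :=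
  Matrix.of fun i j ↦
    inner ℝ (mfderiv (𝓡 n) (𝓡 n) e.symm y (stdVec n i) : TangentSpace (𝓡 n) (e.symm y))
      (mfderiv (𝓡 n) (𝓡 n) e.symm y (stdVec n j) : TangentSpace (𝓡 n) (e.symm y))

/-- The coordinate derivative `∂_l g_ij` at `y`. -/
def metricDeriv (e : OpenPartialHomeomorph M (Coord n)) (y : Coord n) (l i j : Fin n) : ℝ :=
  fderiv ℝ (fun z ↦ metricMatrix e z i j) y (stdVec n l)

/-- The Christoffel symbols of the Levi-Civita connection in the chart `e`:
`Γ^k_ij = ½ ∑_l g^{kl} (∂_i g_jl + ∂_j g_il - ∂_l g_ij)`. -/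
def christoffel (e : OpenPartialHomeomorph M (Coord n)) (y : Coord n) (k i j : Fin n) : ℝ :=
  (1 / 2 : ℝ) * ∑ l, (metricMatrix e y)⁻¹ k l *
    (metricDeriv e y i j l + metricDeriv e y j i l - metricDeriv e y l i j)

/-- A geodesic `γ : [0,1] → M`: a smooth curve with `∇_γ' γ' = 0`, i.e. satisfying in all local
coordinates `γ''^k + ∑ Γ^k_ij γ'^i γ'^j = 0`. Values of `γ` outside `[0,1]` are irrelevant. -/
structure IsGeodesic (γ : ℝ → M) : Prop where
  smooth : ContMDiffOn 𝓘(ℝ, ℝ) (𝓡 n) ∞ γ (Icc 0 1)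
  equation : ∀ t ∈ Icc (0 : ℝ) 1, ∀ e ∈ IsManifold.maximalAtlas (𝓡 n) ∞ M, γ t ∈ e.source →
    ∀ k : Fin n,
      iteratedDerivWithin 2 (fun s ↦ (e (γ s)) k) (Icc 0 1) t
        + ∑ i, ∑ j, christoffel e (e (γ t)) k i j
            * derivWithin (fun s ↦ (e (γ s)) i) (Icc 0 1) t
            * derivWithin (fun s ↦ (e (γ s)) j) (Icc 0 1) t = 0

/-- A geodesic `γ : [0,1] → M` from `x₀` to `x`. -/
structure IsGeodesicFromTo (x₀ x : M) (γ : ℝ → M) : Prop where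
  geodesic : IsGeodesic (n := n) γ
  source : γ 0 = x₀
  target : γ 1 = x

/-- A minimizing geodesic from `x₀` to `x`: its length is the Riemannian distance. -/
structure IsMinGeodesicFromTo (x₀ x : M) (γ : ℝ → M) : Prop
    extends IsGeodesicFromTo (n := n) x₀ x γ where
  minimizing : pathELength (𝓡 n) γ 0 1 = riemannianEDist (𝓡 n) x₀ x

/-- The vector `(v¹, …, vⁿ)` of components of a tangent vector `v = ∑ vⁱ ∂_i` in the chart `e`. -/
def components (e : OpenPartialHomeomorph M (Coord n)) {x : M} (v : TangentSpace (𝓡 n) x) :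
    Coord n :=
  mfderiv (𝓡 n) (𝓡 n) e x v

/-- `X` is a parallel vector field along the curve `γ : [0,1] → M`, i.e. `∇_γ' X = 0`: in all local
coordinates the components `a^k` of `X` satisfy `(a^k)' + ∑ Γ^k_ij γ'^i a^j = 0`. -/
def IsParallelAlong (γ : ℝ → M) (X : ∀ t, TangentSpace (𝓡 n) (γ t)) : Prop :=
  ∀ t ∈ Icc (0 : ℝ) 1, ∀ e ∈ IsManifold.maximalAtlas (𝓡 n) ∞ M, γ t ∈ e.source →
    ∀ k : Fin n,
      HasDerivWithinAt
        (fun s ↦ components e (X s) k)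
        (-∑ i, ∑ j, christoffel e (e (γ t)) k i j
            * derivWithin (fun s ↦ (e (γ s)) i) (Icc 0 1) t
            * components e (X t) j)
        (Icc 0 1) t

/-- The graph of parallel transport `PT : T_{x₀} M → T_x M` along a curve `γ` from `x₀` to `x`:
`w = PT v` if some parallel field along `γ` starts at `v` and ends at `w`. -/
def IsParallelTransport (γ : ℝ → M) {x₀ x : M} (v : TangentSpace (𝓡 n) x₀)
    (w : TangentSpace (𝓡 n) x) : Prop :=
  ∃ X : ∀ t, TangentSpace (𝓡 n) (γ t), IsParallelAlong γ X ∧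
    (⟨γ 0, X 0⟩ : TangentBundle (𝓡 n) M) = ⟨x₀, v⟩ ∧
    (⟨γ 1, X 1⟩ : TangentBundle (𝓡 n) M) = ⟨x, w⟩

open Classical in
/-- The inverse `(PT_{x₀}^x)⁻¹ : T_x M → T_{x₀} M` of parallel transport along `γ`: the (unique)
`v` whose parallel transport along `γ` is `w`. -/
def parallelTransportInv (γ : ℝ → M) (x₀ x : M) (w : TangentSpace (𝓡 n) x) :
    TangentSpace (𝓡 n) x₀ :=
  if h : ∃ v : TangentSpace (𝓡 n) x₀, IsParallelTransport γ v w then h.choose else 0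

/-- `γ : [0,1] → M` is a geodesic with `γ(0) = x` and `γ'(0) = v`. -/
def IsGeodesicWith (x : M) (v : TangentSpace (𝓡 n) x) (γ : ℝ → M) : Prop :=
  IsGeodesic (n := n) γ ∧
    (⟨γ 0, mfderivWithin 𝓘(ℝ, ℝ) (𝓡 n) γ (Icc 0 1) 0 (1 : ℝ)⟩ : TangentBundle (𝓡 n) M) = ⟨x, v⟩

open Classical in
/-- The exponential map: `exp_x v = γ(1)` for the (unique) geodesic `γ : [0,1] → M` with
`γ(0) = x`, `γ'(0) = v`. Where no such geodesic exists it takes the dummy value `x`. -/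
def expMap (x : M) (v : TangentSpace (𝓡 n) x) : M :=
  if h : ∃ γ : ℝ → M, IsGeodesicWith x v γ then h.choose 1 else x

/-- The injectivity radius at `x`: the supremum of the radii `r` such that `exp_x` is defined on
the ball of radius `r` in `T_x M` and is a diffeomorphism of it onto its image. -/
def injectivityRadiusAt (n : ℕ) {M : Type*} [TopologicalSpace M] [ChartedSpace (Coord n) M]
    [RiemannianBundle (fun x : M ↦ TangentSpace (𝓡 n) x)] (x : M) : ℝ≥0∞ :=
  sSup {r : ℝ≥0∞ |
    (∀ v : TangentSpace (𝓡 n) x, ‖v‖ₑ < r → ∃ γ : ℝ → M, IsGeodesicWith x v γ) ∧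
    InjOn (expMap (n := n) x) {v | ‖v‖ₑ < r} ∧
    IsLocalDiffeomorphOn 𝓘(ℝ, TangentSpace (𝓡 n) x) (𝓡 n) ∞ (expMap (n := n) x) {v | ‖v‖ₑ < r}}

/-- The injectivity radius of `M`. -/
def injectivityRadius (n : ℕ) (M : Type*) [TopologicalSpace M] [ChartedSpace (Coord n) M]
    [RiemannianBundle (fun x : M ↦ TangentSpace (𝓡 n) x)] : ℝ≥0∞ :=
  ⨅ x : M, injectivityRadiusAt n x

open Classical in
/-- The inverse `exp_x⁻¹` of the exponential map restricted to the closed `δ`-ball of `T_x M`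
(dummy value `0` at points that are not in the image). -/
def logMap (δ : ℝ) (x y : M) : TangentSpace (𝓡 n) x :=
  if h : ∃ v : TangentSpace (𝓡 n) x, ‖v‖ ≤ δ ∧ expMap x v = y then h.choose else 0

/-- `k = k(x₀, ·)` is a kernel centred at `x₀` with radius `δ`: it vanishes outside the closed
geodesic ball `M(x₀, δ)`, and `δ` is smaller than the injectivity radius of `M`. -/
structure IsKernel (n : ℕ) {M : Type*} [TopologicalSpace M] [ChartedSpace (Coord n) M]
    [RiemannianBundle (fun x : M ↦ TangentSpace (𝓡 n) x)] (x₀ : M) (δ : ℝ) (k : M → ℝ) :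
    Prop where
  pos : 0 < δ
  lt_injectivityRadius : ENNReal.ofReal δ < injectivityRadius n M
  support : ∀ y, ENNReal.ofReal δ < riemannianEDist (𝓡 n) x₀ y → k y = 0

open Classical in
/-- The kernel `k(x, ·)` obtained from `k = k(x₀, ·)` by parallel transport along `γ` from `x₀`
to `x`: it is `y ↦ k (x₀, exp_{x₀} ∘ (PT_{x₀}^x)⁻¹ ∘ exp_x⁻¹ (y))` on the closed geodesic ball
`M(x, δ)` and `0` outside. -/
def transportedKernel (n : ℕ) {M : Type*} [TopologicalSpace M] [ChartedSpace (Coord n) M]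
    [RiemannianBundle (fun x : M ↦ TangentSpace (𝓡 n) x)]
    (x₀ : M) (δ : ℝ) (k : M → ℝ) (γ : ℝ → M) (x y : M) : ℝ :=
  if riemannianEDist (𝓡 n) x y ≤ ENNReal.ofReal δ then
    k (expMap (n := n) x₀ (parallelTransportInv γ x₀ x (logMap δ x y)))
  else 0

end Metric

section Volume

variable (n : ℕ) {M : Type*} [TopologicalSpace M] [ChartedSpace (Coord n) M]
  [RiemannianBundle (fun x : M ↦ TangentSpace (𝓡 n) x)] [MeasurableSpace M]

/-- The measure `√(det g_ij) dx¹ ⋯ dxⁿ` on the domain of the chart `e`, extended by zero to `M`. -/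
def chartVolume (e : OpenPartialHomeomorph M (Coord n)) : Measure M :=
  ((volume.restrict e.target).withDensity
    (fun y ↦ ENNReal.ofReal (Real.sqrt (metricMatrix e y).det))).map e.symm

/-- The Riemannian volume measure. The measures `√(det g_ij) dx¹ ⋯ dxⁿ` of two smooth charts agree
on the overlap of the chart domains, so that their supremum is the measure on `M` which restricts
to `√(det g_ij) dx¹ ⋯ dxⁿ` on the domain of every smooth chart. -/
def riemannianVolume (M : Type*) [TopologicalSpace M] [ChartedSpace (Coord n) M]
    [RiemannianBundle (fun x : M ↦ TangentSpace (𝓡 n) x)] [MeasurableSpace M] : Measure M :=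
  ⨆ e ∈ IsManifold.maximalAtlas (𝓡 n) ∞ M, chartVolume n e

/-- The integrand `y ↦ f(y) k(x, y)` of the parallel transport convolution at `x`, the kernel being
transported along the geodesic `γ` from `x₀` to `x`. -/
def ptcIntegrand (n : ℕ) {M : Type*} [TopologicalSpace M] [ChartedSpace (Coord n) M]
    [RiemannianBundle (fun x : M ↦ TangentSpace (𝓡 n) x)]
    (x₀ : M) (δ : ℝ) (k f : M → ℝ) (γ : ℝ → M) (x y : M) : ℝ :=
  f y * transportedKernel n x₀ δ k γ x y

/-- The parallel transport convolution `(f *_M k)(x) = ∫_M f(y) k(x, y) d_M y`, the kernel being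
transported along the geodesic `γ` from `x₀` to `x`. -/
def ptConvolution (x₀ : M) (δ : ℝ) (k f : M → ℝ) (γ : ℝ → M) (x : M) : ℝ :=
  ∫ y, ptcIntegrand n x₀ δ k f γ x y ∂(riemannianVolume n M)

end Volume

/-- An isometry of Riemannian manifolds: a diffeomorphism preserving the Riemannian metric. -/
def IsRiemannianIsometry {n : ℕ} {M N : Type*}
    [TopologicalSpace M] [ChartedSpace (Coord n) M]
    [RiemannianBundle (fun x : M ↦ TangentSpace (𝓡 n) x)]
    [TopologicalSpace N] [ChartedSpace (Coord n) N]
    [RiemannianBundle (fun x : N ↦ TangentSpace (𝓡 n) x)]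
    (Φ : M ≃ₘ^∞⟮𝓡 n, 𝓡 n⟯ N) : Prop :=
  ∀ (x : M) (v w : TangentSpace (𝓡 n) x),
    inner ℝ (mfderiv (𝓡 n) (𝓡 n) Φ x v) (mfderiv (𝓡 n) (𝓡 n) Φ x w) = inner ℝ v w

end PTC

end

/-! Everything in the convolution is built from the metric, read in charts. If `e` is a chart of
`N`, then `e ∘ Φ` is a chart of `M` (`pullbackChart`), and because `dΦ` preserves inner products the
two charts have the same matrix `g_ij` (`metricMatrix_pullbackChart`). Hence they have the same
Christoffel symbols and the same density `√det g`. So `Φ` carries geodesics to geodesics, parallel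
fields to parallel fields and volume to volume; it preserves lengths of curves, hence distances.
Applying this to `Φ.symm` as well turns implications into equivalences and inequalities into
equalities.

The exponential map and inverse parallel transport are defined by choosing a solution of an ODE, so
naturality also needs uniqueness of that solution (`IsGeodesic.eqOn`, `IsParallelAlong.eq_of_eq`).
Existence is never needed: where no solution exists on one side, none exists on the other, and the
dummy values correspond under `Φ`. For `logMap`, uniqueness comes from `δ < inj`. The integrand on
`N` composed with `Φ` is then the integrand on `M` (`ptcIntegrand_comp`), and a change of variables
along `Φ` finishes. -/

noncomputable section

namespace PTC

open Filter
open scoped Topology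

/-! ### Charts of `M` pulled back from `N`. -/

section Charts

variable {n : ℕ} {M : Type*} [TopologicalSpace M] [ChartedSpace (Coord n) M]
  {N : Type*} [TopologicalSpace N] [ChartedSpace (Coord n) N]

/-- The chart of `M` obtained by precomposing a chart of `N` with a diffeomorphism `M → N`. -/
def pullbackChart (Φ : M ≃ₘ^∞⟮𝓡 n, 𝓡 n⟯ N) (e : OpenPartialHomeomorph N (Coord n)) :
    OpenPartialHomeomorph M (Coord n) :=
  Φ.toHomeomorph.transOpenPartialHomeomorph e

@[simp]
lemma pullbackChart_apply (Φ : M ≃ₘ^∞⟮𝓡 n, 𝓡 n⟯ N) (e : OpenPartialHomeomorph N (Coord n))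
    (x : M) : pullbackChart Φ e x = e (Φ x) := rfl

@[simp]
lemma pullbackChart_target (Φ : M ≃ₘ^∞⟮𝓡 n, 𝓡 n⟯ N) (e : OpenPartialHomeomorph N (Coord n)) :
    (pullbackChart Φ e).target = e.target := rfl

lemma pullbackChart_mem_maximalAtlas [IsManifold (𝓡 n) ∞ M] [IsManifold (𝓡 n) ∞ N]
    (Φ : M ≃ₘ^∞⟮𝓡 n, 𝓡 n⟯ N) {e : OpenPartialHomeomorph N (Coord n)}
    (he : e ∈ IsManifold.maximalAtlas (𝓡 n) ∞ N) :
    pullbackChart Φ e ∈ IsManifold.maximalAtlas (𝓡 n) ∞ M := by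
  rw [IsManifold.mem_maximalAtlas_iff_contMDiffOn]
  refine ⟨?_, ?_⟩
  · exact (contMDiffOn_of_mem_maximalAtlas he).comp Φ.contMDiff.contMDiffOn fun x hx ↦ hx
  · exact Φ.symm.contMDiff.comp_contMDiffOn (contMDiffOn_symm_of_mem_maximalAtlas he)

lemma mdifferentiableAt_of_mem_maximalAtlas_infty [IsManifold (𝓡 n) ∞ M]
    {e : OpenPartialHomeomorph M (Coord n)}
    (he : e ∈ IsManifold.maximalAtlas (𝓡 n) ∞ M) {x : M} (hx : x ∈ e.source) :
    MDifferentiableAt (𝓡 n) (𝓡 n) e x :=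
  (contMDiffAt_of_mem_maximalAtlas he hx).mdifferentiableAt (by simp)

lemma mdifferentiableAt_symm_of_mem_maximalAtlas_infty [IsManifold (𝓡 n) ∞ M]
    {e : OpenPartialHomeomorph M (Coord n)}
    (he : e ∈ IsManifold.maximalAtlas (𝓡 n) ∞ M) {y : Coord n} (hy : y ∈ e.target) :
    MDifferentiableAt (𝓡 n) (𝓡 n) e.symm y :=
  (contMDiffAt_symm_of_mem_maximalAtlas he hy).mdifferentiableAt (by simp)

lemma diffeomorph_mdifferentiableAt (Φ : M ≃ₘ^∞⟮𝓡 n, 𝓡 n⟯ N) (x : M) :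
    MDifferentiableAt (𝓡 n) (𝓡 n) Φ x :=
  Φ.mdifferentiable (by simp) x

/-- The components of `v` in a pulled back chart are those of `dΦ v` in the original chart. -/
lemma components_pullbackChart [IsManifold (𝓡 n) ∞ N] (Φ : M ≃ₘ^∞⟮𝓡 n, 𝓡 n⟯ N)
    {e : OpenPartialHomeomorph N (Coord n)} (he : e ∈ IsManifold.maximalAtlas (𝓡 n) ∞ N)
    {x : M} (hx : Φ x ∈ e.source) (v : TangentSpace (𝓡 n) x) :
    components (pullbackChart Φ e) v = components e (mfderiv (𝓡 n) (𝓡 n) Φ x v) := by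
  have h : mfderiv (𝓡 n) (𝓡 n) (e ∘ Φ) x =
      (mfderiv (𝓡 n) (𝓡 n) e (Φ x)).comp (mfderiv (𝓡 n) (𝓡 n) Φ x) :=
    mfderiv_comp x (mdifferentiableAt_of_mem_maximalAtlas_infty he hx)
      (diffeomorph_mdifferentiableAt Φ x)
  exact DFunLike.congr_fun h v

lemma mfderiv_apply_mfderiv_symm (Φ : M ≃ₘ^∞⟮𝓡 n, 𝓡 n⟯ N) (x : M) (w : TangentSpace (𝓡 n) (Φ x)) :
    mfderiv (𝓡 n) (𝓡 n) Φ x (mfderiv (𝓡 n) (𝓡 n) Φ.symm (Φ x) w) = w := by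
  have h := (mfderiv_comp (Φ x) (diffeomorph_mdifferentiableAt Φ (Φ.symm (Φ x)))
      (diffeomorph_mdifferentiableAt Φ.symm (Φ x)))
  have h' : Φ ∘ Φ.symm = id := funext fun y ↦ Φ.apply_symm_apply y
  rw [h', mfderiv_id] at h
  have h2 := (DFunLike.congr_fun h w).symm
  rw [Φ.symm_apply_apply] at h2
  exact h2

end Charts

/-! ### The metric and its Christoffel symbols in pulled back charts. -/

section Isometry

variable {n : ℕ} {M : Type*} [TopologicalSpace M] [ChartedSpace (Coord n) M]
  [RiemannianBundle (fun x : M ↦ TangentSpace (𝓡 n) x)]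
  {N : Type*} [TopologicalSpace N] [ChartedSpace (Coord n) N]
  [RiemannianBundle (fun x : N ↦ TangentSpace (𝓡 n) x)]
  {Φ : M ≃ₘ^∞⟮𝓡 n, 𝓡 n⟯ N}

/-- All tangent spaces are definitionally the model space, so only the inner product depends on the
base point. This handles `Φ.symm (Φ x)` in place of `x`. -/
lemma inner_tangentSpace_congr {p q : M} (h : p = q) (v w : TangentSpace (𝓡 n) p) :
    inner ℝ v w = inner ℝ (E := TangentSpace (𝓡 n) q) v w := by
  subst h
  rfl

lemma IsRiemannianIsometry.symm (hΦ : IsRiemannianIsometry Φ) :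
    IsRiemannianIsometry Φ.symm := by
  intro y v w
  obtain ⟨x, rfl⟩ := Φ.surjective y
  have h := hΦ x (mfderiv (𝓡 n) (𝓡 n) Φ.symm (Φ x) v) (mfderiv (𝓡 n) (𝓡 n) Φ.symm (Φ x) w)
  rw [mfderiv_apply_mfderiv_symm, mfderiv_apply_mfderiv_symm] at h
  rw [h]
  exact inner_tangentSpace_congr (Φ.symm_apply_apply x) _ _

lemma IsRiemannianIsometry.norm_mfderiv (hΦ : IsRiemannianIsometry Φ) (x : M)
    (v : TangentSpace (𝓡 n) x) : ‖mfderiv (𝓡 n) (𝓡 n) Φ x v‖ = ‖v‖ := by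
  rw [@norm_eq_sqrt_real_inner _ _ _ (mfderiv (𝓡 n) (𝓡 n) Φ x v), @norm_eq_sqrt_real_inner _ _ _ v,
    hΦ]

lemma IsRiemannianIsometry.enorm_mfderiv (hΦ : IsRiemannianIsometry Φ) (x : M)
    (v : TangentSpace (𝓡 n) x) : ‖mfderiv (𝓡 n) (𝓡 n) Φ x v‖ₑ = ‖v‖ₑ := by
  rw [← ofReal_norm, ← ofReal_norm, hΦ.norm_mfderiv]

variable [IsManifold (𝓡 n) ∞ N] {e : OpenPartialHomeomorph N (Coord n)}

/-- The inverse chart is `Φ.symm ∘ e.symm`; by the chain rule its coordinate vectors are the images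
under `dΦ⁻¹` of those of `e`, and `Φ.symm` is an isometry. -/
lemma IsRiemannianIsometry.metricMatrix_pullbackChart
    (hΦ : IsRiemannianIsometry Φ) (he : e ∈ IsManifold.maximalAtlas (𝓡 n) ∞ N)
    {y : Coord n} (hy : y ∈ e.target) :
    metricMatrix (pullbackChart Φ e) y = metricMatrix e y := by
  ext i j
  have h (u : Coord n) : mfderiv (𝓡 n) (𝓡 n) (pullbackChart Φ e).symm y u =
      mfderiv (𝓡 n) (𝓡 n) Φ.symm (e.symm y) (mfderiv (𝓡 n) (𝓡 n) e.symm y u) := by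
    have h : mfderiv (𝓡 n) (𝓡 n) (Φ.symm ∘ e.symm) y =
        (mfderiv (𝓡 n) (𝓡 n) Φ.symm (e.symm y)).comp (mfderiv (𝓡 n) (𝓡 n) e.symm y) :=
      mfderiv_comp y (diffeomorph_mdifferentiableAt Φ.symm _)
        (mdifferentiableAt_symm_of_mem_maximalAtlas_infty he hy)
    exact DFunLike.congr_fun h u
  simp only [metricMatrix, Matrix.of_apply]
  rw [h, h]
  exact hΦ.symm _ _ _

lemma IsRiemannianIsometry.metricDeriv_pullbackChart
    (hΦ : IsRiemannianIsometry Φ) (he : e ∈ IsManifold.maximalAtlas (𝓡 n) ∞ N)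
    {y : Coord n} (hy : y ∈ e.target) (l i j : Fin n) :
    metricDeriv (pullbackChart Φ e) y l i j = metricDeriv e y l i j := by
  have h : (fun z ↦ metricMatrix (pullbackChart Φ e) z i j) =ᶠ[𝓝 y]
      fun z ↦ metricMatrix e z i j := by
    filter_upwards [e.open_target.mem_nhds hy] with z hz
    rw [hΦ.metricMatrix_pullbackChart he hz]
  simp only [metricDeriv, h.fderiv_eq]

lemma IsRiemannianIsometry.christoffel_pullbackChart
    (hΦ : IsRiemannianIsometry Φ) (he : e ∈ IsManifold.maximalAtlas (𝓡 n) ∞ N)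
    {y : Coord n} (hy : y ∈ e.target) (k i j : Fin n) :
    christoffel (pullbackChart Φ e) y k i j = christoffel e y k i j := by
  simp only [christoffel, hΦ.metricDeriv_pullbackChart he hy, hΦ.metricMatrix_pullbackChart he hy]

end Isometry

/-! ### Invariance of the Riemannian volume. -/

section Volume

variable {n : ℕ} {M : Type*} [TopologicalSpace M] [ChartedSpace (Coord n) M]
  [RiemannianBundle (fun x : M ↦ TangentSpace (𝓡 n) x)]
  [MeasurableSpace M] [BorelSpace M]
  {N : Type*} [TopologicalSpace N] [ChartedSpace (Coord n) N]
  [RiemannianBundle (fun x : N ↦ TangentSpace (𝓡 n) x)] [IsManifold (𝓡 n) ∞ N]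
  [MeasurableSpace N] [BorelSpace N]
  {Φ : M ≃ₘ^∞⟮𝓡 n, 𝓡 n⟯ N}

lemma IsRiemannianIsometry.chartVolume_pullbackChart
    (hΦ : IsRiemannianIsometry Φ) {e : OpenPartialHomeomorph N (Coord n)}
    (he : e ∈ IsManifold.maximalAtlas (𝓡 n) ∞ N) :
    chartVolume n (pullbackChart Φ e) = (chartVolume n e).map Φ.symm := by
  have h : (volume.restrict e.target).withDensity
        (fun y ↦ ENNReal.ofReal (Real.sqrt (metricMatrix (pullbackChart Φ e) y).det)) =
      (volume.restrict e.target).withDensity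
        (fun y ↦ ENNReal.ofReal (Real.sqrt (metricMatrix e y).det)) := by
    refine withDensity_congr_ae ?_
    filter_upwards [ae_restrict_mem e.open_target.measurableSet] with y hy
    rw [hΦ.metricMatrix_pullbackChart he hy]
  have hm : AEMeasurable e.symm ((volume.restrict e.target).withDensity
      (fun y ↦ ENNReal.ofReal (Real.sqrt (metricMatrix e y).det))) :=
    (e.continuousOn_symm.aemeasurable e.open_target.measurableSet).mono_ac
      (withDensity_absolutelyContinuous _ _)
  rw [chartVolume, pullbackChart_target, h, chartVolume,
    AEMeasurable.map_map_of_aemeasurable Φ.symm.continuous.measurable.aemeasurable hm]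
  rfl

variable [IsManifold (𝓡 n) ∞ M]

/-- Each chart measure on `N` is the push-forward of one of the measures whose supremum is the
volume of `M`. The reverse inequality is this one for `Φ.symm`. -/
lemma IsRiemannianIsometry.riemannianVolume_le_map (hΦ : IsRiemannianIsometry Φ) :
    riemannianVolume n N ≤ (riemannianVolume n M).map Φ := by
  refine iSup₂_le fun e he ↦ ?_
  have h : (chartVolume n (pullbackChart Φ e)).map Φ = chartVolume n e := by
    rw [hΦ.chartVolume_pullbackChart he,
      Measure.map_map Φ.continuous.measurable Φ.symm.continuous.measurable]
    have h' : Φ ∘ Φ.symm = id := funext fun y ↦ Φ.apply_symm_apply y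
    rw [h', Measure.map_id]
  rw [← h]
  refine Measure.map_mono ?_ Φ.continuous.measurable
  exact le_iSup₂_of_le (pullbackChart Φ e) (pullbackChart_mem_maximalAtlas Φ he) le_rfl

lemma IsRiemannianIsometry.map_riemannianVolume (hΦ : IsRiemannianIsometry Φ) :
    (riemannianVolume n M).map Φ = riemannianVolume n N := by
  refine le_antisymm ?_ hΦ.riemannianVolume_le_map
  have h := Measure.map_mono hΦ.symm.riemannianVolume_le_map Φ.continuous.measurable
  rw [Measure.map_map Φ.continuous.measurable Φ.symm.continuous.measurable] at h
  have h' : Φ ∘ Φ.symm = id := funext fun y ↦ Φ.apply_symm_apply y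
  rwa [h', Measure.map_id] at h

end Volume

/-! ### Local uniqueness for ODEs on a closed interval. -/

section ODE

/-- Two solutions on `[a, b]` of an ODE with locally Lipschitz right hand side agree at `t` if and
only if they agree at all points of `[a, b]` close to `t`. -/
lemma eventually_eq_iff_of_hasDerivWithinAt {E : Type*} [NormedAddCommGroup E] [NormedSpace ℝ E]
    {v : ℝ → E → E} {f g : ℝ → E} {a b t : ℝ} (ht : t ∈ Icc a b) {K : NNReal} {U : Set E}
    (hU : U ∈ 𝓝 (f t)) (hv : ∀ᶠ s in 𝓝[Icc a b] t, LipschitzOnWith K (v s) U)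
    (hf : ∀ᶠ s in 𝓝[Icc a b] t, HasDerivWithinAt f (v s (f s)) (Icc a b) s)
    (hg : ∀ᶠ s in 𝓝[Icc a b] t, HasDerivWithinAt g (v s (g s)) (Icc a b) s) :
    ∀ᶠ s in 𝓝[Icc a b] t, f t = g t ↔ f s = g s := by
  have hfc : ContinuousWithinAt f (Icc a b) t := (hf.self_of_nhdsWithin ht).continuousWithinAt
  have hgc : ContinuousWithinAt g (Icc a b) t := (hg.self_of_nhdsWithin ht).continuousWithinAt
  by_cases hfg : f t = g t
  swap
  -- Values that differ at `t` differ nearby by continuity alone.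
  · filter_upwards [(hfc.sub hgc).eventually_ne (sub_ne_zero.2 hfg)] with s hs
    simp [hfg, sub_ne_zero.1 hs]
  have hfU : ∀ᶠ s in 𝓝[Icc a b] t, f s ∈ U := hfc hU
  have hgU : ∀ᶠ s in 𝓝[Icc a b] t, g s ∈ U := hgc (hfg ▸ hU)
  have hall := hv.and (hf.and (hg.and (hfU.and hgU)))
  rw [eventually_nhdsWithin_iff, Metric.eventually_nhds_iff] at hall
  obtain ⟨ε, hε, hall⟩ := hall
  -- The half `ε / 2` keeps the closed interval `[c, d]` inside the open `ε`-ball; clipping to `[a,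
  -- b]` lets `t` be an endpoint. Uniqueness is then applied on each side of `t`.
  obtain ⟨c, hc⟩ : ∃ c, c = max a (t - ε / 2) := ⟨_, rfl⟩
  obtain ⟨d, hd⟩ : ∃ d, d = min b (t + ε / 2) := ⟨_, rfl⟩
  have hct : c ≤ t := hc ▸ max_le ht.1 (by linarith)
  have htd : t ≤ d := hd ▸ le_min ht.2 (by linarith)
  have hsub : Icc c d ⊆ Icc a b :=
    Icc_subset_Icc (hc ▸ le_max_left _ _) (hd ▸ min_le_left _ _)
  have hloc : ∀ s ∈ Icc c d, LipschitzOnWith K (v s) U ∧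
      HasDerivWithinAt f (v s (f s)) (Icc c d) s ∧
      HasDerivWithinAt g (v s (g s)) (Icc c d) s ∧ f s ∈ U ∧ g s ∈ U := by
    intro s hs
    have h1 : t - ε / 2 ≤ s := (hc ▸ le_max_right a (t - ε / 2) : t - ε / 2 ≤ c).trans hs.1
    have h2 : s ≤ t + ε / 2 := hs.2.trans (hd ▸ min_le_right b (t + ε / 2))
    have h3 : dist s t < ε := by
      rw [Real.dist_eq, abs_lt]
      constructor <;> linarith
    obtain ⟨p1, p2, p3, p4, p5⟩ := hall h3 (hsub hs)
    exact ⟨p1, p2.mono hsub, p3.mono hsub, p4, p5⟩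
  have hfcd : ContinuousOn f (Icc c d) := fun s hs ↦ (hloc s hs).2.1.continuousWithinAt
  have hgcd : ContinuousOn g (Icc c d) := fun s hs ↦ (hloc s hs).2.2.1.continuousWithinAt
  have hright : EqOn f g (Icc t d) := by
    have hs' : ∀ s ∈ Ico t d, s ∈ Icc c d := fun s hs ↦ ⟨hct.trans hs.1, hs.2.le⟩
    have hm : ∀ s ∈ Ico t d, Icc c d ∈ 𝓝[Ici s] s := fun s hs ↦
      mem_of_superset (Icc_mem_nhdsGE hs.2) (Icc_subset_Icc_left (hct.trans hs.1))
    exact ODE_solution_unique_of_mem_Icc_right (v := v) (s := fun _ ↦ U)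
      (fun s hs ↦ (hloc s (hs' s hs)).1)
      (hfcd.mono (Icc_subset_Icc_left hct))
      (fun s hs ↦ (hloc s (hs' s hs)).2.1.mono_of_mem_nhdsWithin (hm s hs))
      (fun s hs ↦ (hloc s (hs' s hs)).2.2.2.1)
      (hgcd.mono (Icc_subset_Icc_left hct))
      (fun s hs ↦ (hloc s (hs' s hs)).2.2.1.mono_of_mem_nhdsWithin (hm s hs))
      (fun s hs ↦ (hloc s (hs' s hs)).2.2.2.2) hfg
  have hleft : EqOn f g (Icc c t) := by
    have hs' : ∀ s ∈ Ioc c t, s ∈ Icc c d := fun s hs ↦ ⟨hs.1.le, hs.2.trans htd⟩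
    have hm : ∀ s ∈ Ioc c t, Icc c d ∈ 𝓝[Iic s] s := fun s hs ↦
      mem_of_superset (Icc_mem_nhdsLE hs.1) (Icc_subset_Icc_right (hs.2.trans htd))
    exact ODE_solution_unique_of_mem_Icc_left (v := v) (s := fun _ ↦ U)
      (fun s hs ↦ (hloc s (hs' s hs)).1)
      (hfcd.mono (Icc_subset_Icc_right htd))
      (fun s hs ↦ (hloc s (hs' s hs)).2.1.mono_of_mem_nhdsWithin (hm s hs))
      (fun s hs ↦ (hloc s (hs' s hs)).2.2.2.1)
      (hgcd.mono (Icc_subset_Icc_right htd))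
      (fun s hs ↦ (hloc s (hs' s hs)).2.2.1.mono_of_mem_nhdsWithin (hm s hs))
      (fun s hs ↦ (hloc s (hs' s hs)).2.2.2.2) hfg
  rw [eventually_nhdsWithin_iff, Metric.eventually_nhds_iff]
  refine ⟨ε / 2, by linarith, fun s hs hsab ↦ ⟨fun _ ↦ ?_, fun _ ↦ hfg⟩⟩
  rw [Real.dist_eq, abs_lt] at hs
  rcases le_total t s with h | h
  · exact hright ⟨h, hd ▸ le_min hsab.2 (by linarith)⟩
  · exact hleft ⟨hc ▸ max_le hsab.1 (by linarith), h⟩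

end ODE

/-! ### Smoothness of the metric and the Christoffel symbols in a chart. -/

section Smoothness

variable {n : ℕ} {M : Type*} [TopologicalSpace M] [ChartedSpace (Coord n) M]
  [IsManifold (𝓡 n) ∞ M] {e : OpenPartialHomeomorph M (Coord n)}

lemma mfderiv_symm_comp_mfderiv_chart (he : e ∈ IsManifold.maximalAtlas (𝓡 n) ∞ M) {x : M}
    (hx : x ∈ e.source) :
    (mfderiv (𝓡 n) (𝓡 n) e.symm (e x)).comp (mfderiv (𝓡 n) (𝓡 n) e x) =
      ContinuousLinearMap.id ℝ (TangentSpace (𝓡 n) x) := by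
  have h := mfderiv_comp x (mdifferentiableAt_symm_of_mem_maximalAtlas_infty he (e.map_source hx))
    (mdifferentiableAt_of_mem_maximalAtlas_infty he hx)
  have h' : e.symm ∘ e =ᶠ[𝓝 x] id := by
    filter_upwards [e.open_source.mem_nhds hx] with y hy using e.left_inv hy
  rw [h'.mfderiv_eq, mfderiv_id] at h
  exact h.symm

lemma mfderiv_chart_comp_mfderiv_symm (he : e ∈ IsManifold.maximalAtlas (𝓡 n) ∞ M) {y : Coord n}
    (hy : y ∈ e.target) :
    (mfderiv (𝓡 n) (𝓡 n) e (e.symm y)).comp (mfderiv (𝓡 n) (𝓡 n) e.symm y) =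
      ContinuousLinearMap.id ℝ (TangentSpace (𝓡 n) y) := by
  have h := mfderiv_comp y (mdifferentiableAt_of_mem_maximalAtlas_infty he (e.map_target hy))
    (mdifferentiableAt_symm_of_mem_maximalAtlas_infty he hy)
  have h' : e ∘ e.symm =ᶠ[𝓝 y] id := by
    filter_upwards [e.open_target.mem_nhds hy] with z hz using e.right_inv hz
  rw [h'.mfderiv_eq, mfderiv_id] at h
  exact h.symm

lemma components_injective (he : e ∈ IsManifold.maximalAtlas (𝓡 n) ∞ M) {x : M}
    (hx : x ∈ e.source) :
    Function.Injective (components e : TangentSpace (𝓡 n) x → Coord n) := by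
  intro v w hvw
  have h := mfderiv_symm_comp_mfderiv_chart he hx
  have hv := DFunLike.congr_fun h v
  have hw := DFunLike.congr_fun h w
  exact hv.symm.trans ((congrArg (mfderiv (𝓡 n) (𝓡 n) e.symm (e x)) hvw).trans hw)

variable [RiemannianBundle (fun x : M ↦ TangentSpace (𝓡 n) x)]

/-- The matrix is the Gram matrix of the coordinate vectors, which are independent because `d(e⁻¹)`
is injective. -/
lemma metricMatrix_det_ne_zero (he : e ∈ IsManifold.maximalAtlas (𝓡 n) ∞ M) {y : Coord n}
    (hy : y ∈ e.target) : (metricMatrix e y).det ≠ 0 := by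
  have hli : LinearIndependent ℝ (fun i ↦
      (mfderiv (𝓡 n) (𝓡 n) e.symm y (stdVec n i) : TangentSpace (𝓡 n) (e.symm y))) := by
    have hstd : LinearIndependent ℝ (stdVec n) := by
      have := (EuclideanSpace.basisFun (Fin n) ℝ).toBasis.linearIndependent
      convert! this using 1
      ext1 i
      simp [stdVec]
    refine hstd.map' (mfderiv (𝓡 n) (𝓡 n) e.symm y).toLinearMap ?_
    refine LinearMap.ker_eq_bot.2 fun v w hvw ↦ ?_
    have h := mfderiv_chart_comp_mfderiv_symm he hy
    have hv := DFunLike.congr_fun h v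
    have hw := DFunLike.congr_fun h w
    exact hv.symm.trans ((congrArg (mfderiv (𝓡 n) (𝓡 n) e (e.symm y)) hvw).trans hw)
  exact (Matrix.posDef_gram_of_linearIndependent (𝕜 := ℝ) hli).det_pos.ne'

variable [IsContMDiffRiemannianBundle (𝓡 n) ∞ (Coord n) (fun x : M ↦ TangentSpace (𝓡 n) x)]

lemma contDiffOn_metricMatrix (he : e ∈ IsManifold.maximalAtlas (𝓡 n) ∞ M) (i j : Fin n) :
    ContDiffOn ℝ ∞ (fun y ↦ metricMatrix e y i j) e.target := by
  have hs (u : Coord n) : ContMDiffOn (𝓡 n) ((𝓡 n).prod 𝓘(ℝ, Coord n)) ∞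
      (fun y ↦ (⟨e.symm y, mfderiv (𝓡 n) (𝓡 n) e.symm y u⟩ :
        TotalSpace (Coord n) (fun x : M ↦ TangentSpace (𝓡 n) x))) e.target := by
    -- The coordinate field is the tangent map of `e.symm` applied to a constant field.
    have h1 := (contMDiffOn_symm_of_mem_maximalAtlas he).contMDiffOn_tangentMapWithin
      (m := ∞) (by simp) e.open_target.uniqueMDiffOn
    have h2 : ContMDiff (𝓡 n) ((𝓡 n).prod 𝓘(ℝ, Coord n)) ∞
        (fun y : Coord n ↦ (⟨y, u⟩ : TangentBundle (𝓡 n) (Coord n))) := by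
      exact (contMDiff_vectorSpace_iff_contDiff (V := fun _ ↦ u)).2 contDiff_const
    refine (h1.comp h2.contMDiffOn fun y hy ↦ hy).congr fun y hy ↦ ?_
    simp only [Function.comp_apply, tangentMapWithin]
    rw [mfderivWithin_of_isOpen e.open_target hy]
  rw [← contMDiffOn_iff_contDiffOn]
  exact (hs (stdVec n i)).inner_bundle (hs (stdVec n j))

lemma contDiffOn_metricDeriv (he : e ∈ IsManifold.maximalAtlas (𝓡 n) ∞ M) (l i j : Fin n) :
    ContDiffOn ℝ ∞ (fun y ↦ metricDeriv e y l i j) e.target :=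
  ((contDiffOn_metricMatrix he i j).fderiv_of_isOpen e.open_target (m := ∞) (by simp)).clm_apply
    contDiffOn_const

/-- Cramer's rule: the entries of the adjugate are determinants of the matrix with one row replaced
by a constant one. -/
lemma contDiffOn_metricMatrix_inv (he : e ∈ IsManifold.maximalAtlas (𝓡 n) ∞ M) (i j : Fin n) :
    ContDiffOn ℝ ∞ (fun y ↦ (metricMatrix e y)⁻¹ i j) e.target := by
  have hdet {A : Coord n → Matrix (Fin n) (Fin n) ℝ}
      (hA : ∀ i j, ContDiffOn ℝ ∞ (fun y ↦ A y i j) e.target) :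
      ContDiffOn ℝ ∞ (fun y ↦ (A y).det) e.target := by
    simp only [Matrix.det_apply]
    exact ContDiffOn.sum fun σ _ ↦ (contDiffOn_prod fun k _ ↦ hA _ _).const_smul _
  have hg := contDiffOn_metricMatrix he
  have hadj : ContDiffOn ℝ ∞ (fun y ↦ (metricMatrix e y).adjugate i j) e.target := by
    simp only [Matrix.adjugate_apply]
    refine hdet fun k l ↦ ?_
    by_cases hkj : k = j
    · subst hkj
      simpa using contDiffOn_const
    · simpa [Matrix.updateRow_ne hkj] using hg k l
  refine (((hdet hg).inv fun y hy ↦ metricMatrix_det_ne_zero he hy).mul hadj).congr fun y _ ↦ ?_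
  simp [Matrix.inv_def]

lemma contDiffOn_christoffel (he : e ∈ IsManifold.maximalAtlas (𝓡 n) ∞ M) (k i j : Fin n) :
    ContDiffOn ℝ ∞ (fun y ↦ christoffel e y k i j) e.target := by
  refine contDiffOn_const.mul (ContDiffOn.sum fun l _ ↦ ?_)
  exact (contDiffOn_metricMatrix_inv he k l).mul
    (((contDiffOn_metricDeriv he i j l).add (contDiffOn_metricDeriv he j i l)).sub
      (contDiffOn_metricDeriv he l i j))

end Smoothness

/-! ### Curves and tangent vectors in coordinates. -/

section Curves

variable {n : ℕ} {M : Type*} [TopologicalSpace M] [ChartedSpace (Coord n) M]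
  {e : OpenPartialHomeomorph M (Coord n)} {γ : ℝ → M}

lemma contDiffWithinAt_chart_comp (he : e ∈ IsManifold.maximalAtlas (𝓡 n) ∞ M)
    (hγ : ContMDiffOn 𝓘(ℝ, ℝ) (𝓡 n) ∞ γ (Icc 0 1)) {s : ℝ} (hs : s ∈ Icc (0 : ℝ) 1)
    (hse : γ s ∈ e.source) (k : Fin n) :
    ContDiffWithinAt ℝ ∞ (fun s ↦ e (γ s) k) (Icc 0 1) s := by
  have h : ContMDiffWithinAt 𝓘(ℝ, ℝ) (𝓡 n) ∞ (e ∘ γ) (Icc 0 1) s :=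
    (contMDiffAt_of_mem_maximalAtlas he hse).comp_contMDiffWithinAt s (hγ s hs)
  exact contDiffWithinAt_euclidean.1 h.contDiffWithinAt k

variable [IsManifold (𝓡 n) ∞ M]

/-- The components of the velocity of a curve are the derivatives of its coordinates. -/
lemma components_velocity (he : e ∈ IsManifold.maximalAtlas (𝓡 n) ∞ M)
    (hγ : ContMDiffOn 𝓘(ℝ, ℝ) (𝓡 n) ∞ γ (Icc 0 1)) {s : ℝ} (hs : s ∈ Icc (0 : ℝ) 1)
    (hse : γ s ∈ e.source) (k : Fin n) :
    components e (mfderivWithin 𝓘(ℝ, ℝ) (𝓡 n) γ (Icc 0 1) s (1 : ℝ)) k =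
      derivWithin (fun s ↦ e (γ s) k) (Icc 0 1) s := by
  have h1 := (mdifferentiableAt_of_mem_maximalAtlas_infty he hse).hasMFDerivAt
  have h2 := ((hγ s hs).mdifferentiableWithinAt (by simp)).hasMFDerivWithinAt
  have h3 := (h1.comp_hasMFDerivWithinAt s h2).hasFDerivWithinAt
  have h4 := (EuclideanSpace.proj k : Coord n →L[ℝ] ℝ).hasFDerivAt
    (x := e (γ s)) |>.comp_hasFDerivWithinAt s h3
  exact (h4.hasDerivWithinAt.derivWithin (uniqueDiffOn_Icc zero_lt_one s hs)).symm

/-- The coordinates in the chart `e` of a point of the tangent bundle. -/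
def tangentCoord (e : OpenPartialHomeomorph M (Coord n)) (p : TangentBundle (𝓡 n) M) :
    (Fin n → ℝ) × (Fin n → ℝ) :=
  (fun k ↦ e p.1 k, fun k ↦ components e p.2 k)

lemma tangentCoord_injOn (he : e ∈ IsManifold.maximalAtlas (𝓡 n) ∞ M)
    {p q : TangentBundle (𝓡 n) M} (hp : p.1 ∈ e.source) (hq : q.1 ∈ e.source)
    (h : tangentCoord e p = tangentCoord e q) : p = q := by
  obtain ⟨x, v⟩ := p
  obtain ⟨y, w⟩ := q
  simp only [tangentCoord, Prod.mk.injEq] at h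
  obtain ⟨h1, h2⟩ := h
  have hxy : x = y := e.injOn hp hq (by ext k; exact congrFun h1 k)
  subst hxy
  have : v = w := components_injective he hp (by ext k; exact congrFun h2 k)
  rw [this]

end Curves

/-! ### Uniqueness of geodesics and of parallel fields. -/

section Uniqueness

variable {n : ℕ} {M : Type*} [TopologicalSpace M] [ChartedSpace (Coord n) M]
  [IsManifold (𝓡 n) ∞ M] [RiemannianBundle (fun x : M ↦ TangentSpace (𝓡 n) x)]
  {e : OpenPartialHomeomorph M (Coord n)}

/-- The geodesic equation in the chart `e`, as a first order system. -/
def geodesicField (e : OpenPartialHomeomorph M (Coord n)) (p : (Fin n → ℝ) × (Fin n → ℝ)) :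
    (Fin n → ℝ) × (Fin n → ℝ) :=
  (p.2, fun k ↦ -∑ i, ∑ j, christoffel e (WithLp.toLp 2 p.1) k i j * p.2 i * p.2 j)

/-- The coordinates of the velocity of a geodesic solve the geodesic system. -/
lemma IsGeodesic.hasDerivWithinAt_tangentCoord {γ : ℝ → M} (hγ : IsGeodesic (n := n) γ)
    (he : e ∈ IsManifold.maximalAtlas (𝓡 n) ∞ M) {t : ℝ} (ht : t ∈ Icc (0 : ℝ) 1)
    (hte : γ t ∈ e.source) :
    HasDerivWithinAt
      (fun s ↦ tangentCoord e ⟨γ s, mfderivWithin 𝓘(ℝ, ℝ) (𝓡 n) γ (Icc 0 1) s (1 : ℝ)⟩)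
      (geodesicField e (tangentCoord e
        ⟨γ t, mfderivWithin 𝓘(ℝ, ℝ) (𝓡 n) γ (Icc 0 1) t (1 : ℝ)⟩)) (Icc 0 1) t := by
  have hu : UniqueDiffOn ℝ (Icc (0 : ℝ) 1) := uniqueDiffOn_Icc zero_lt_one
  have hc (k : Fin n) := contDiffWithinAt_chart_comp he hγ.smooth ht hte k
  refine HasDerivWithinAt.prodMk (hasDerivWithinAt_pi.2 fun k ↦ ?_)
    (hasDerivWithinAt_pi.2 fun k ↦ ?_)
  · simp only [tangentCoord]
    rw [components_velocity he hγ.smooth ht hte k]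
    exact ((hc k).differentiableWithinAt (by simp)).hasDerivWithinAt
  · have hv : ∀ᶠ s in 𝓝[Icc 0 1] t,
        components e (mfderivWithin 𝓘(ℝ, ℝ) (𝓡 n) γ (Icc 0 1) s (1 : ℝ)) k =
          derivWithin (fun s ↦ e (γ s) k) (Icc 0 1) s := by
      filter_upwards [self_mem_nhdsWithin,
        (hγ.smooth.continuousOn t ht) (e.open_source.mem_nhds hte)] with s hs hse
      exact components_velocity he hγ.smooth hs hse k
    have hd := (((hc k).derivWithin hu (m := 1) (by norm_cast) ht).differentiableWithinAt
      (by simp)).hasDerivWithinAt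
    refine (hd.congr_of_eventuallyEq hv (components_velocity he hγ.smooth ht hte k)).congr_deriv ?_
    have heq := hγ.equation t ht e he hte k
    have h2 : iteratedDerivWithin 2 (fun s ↦ e (γ s) k) (Icc 0 1) t =
        derivWithin (derivWithin (fun s ↦ e (γ s) k) (Icc 0 1)) (Icc 0 1) t := by
      rw [iteratedDerivWithin_succ, iteratedDerivWithin_one]
    rw [h2] at heq
    rw [eq_neg_of_add_eq_zero_left heq]
    simp only [tangentCoord, components_velocity he hγ.smooth ht hte]

variable
  [IsContMDiffRiemannianBundle (𝓡 n) ∞ (Coord n) (fun x : M ↦ TangentSpace (𝓡 n) x)]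

/-- Being `C¹` makes the field locally Lipschitz, as ODE uniqueness requires. -/
lemma contDiffAt_geodesicField (he : e ∈ IsManifold.maximalAtlas (𝓡 n) ∞ M)
    {p : (Fin n → ℝ) × (Fin n → ℝ)} (hp : WithLp.toLp 2 p.1 ∈ e.target) :
    ContDiffAt ℝ 1 (geodesicField e) p := by
  have hΓ (k i j : Fin n) : ContDiffAt ℝ 1
      (fun p : (Fin n → ℝ) × (Fin n → ℝ) ↦ christoffel e (WithLp.toLp 2 p.1) k i j) p := by
    have h := ((contDiffOn_christoffel he k i j).contDiffAt (e.open_target.mem_nhds hp)).of_le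
      (m := 1) (by simp)
    have h' : ContDiffAt ℝ 1
        (fun p : (Fin n → ℝ) × (Fin n → ℝ) ↦ (WithLp.toLp 2 p.1 : Coord n)) p :=
      PiLp.contDiff_toLp.contDiffAt.comp p contDiffAt_fst
    exact ContDiffAt.comp (g := fun y ↦ christoffel e y k i j) p h h'
  have hw (i : Fin n) : ContDiffAt ℝ 1 (fun p : (Fin n → ℝ) × (Fin n → ℝ) ↦ p.2 i) p := by
    fun_prop
  refine contDiffAt_snd.prodMk (contDiffAt_pi.2 fun k ↦ ?_)
  exact (ContDiffAt.sum fun i _ ↦ ContDiffAt.sum fun j _ ↦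
    ((hΓ k i j).mul (hw i)).mul (hw j)).neg

/-- A geodesic is determined by its initial velocity. -/
theorem IsGeodesic.eqOn [T2Space M] {γ₁ γ₂ : ℝ → M} (h₁ : IsGeodesic (n := n) γ₁)
    (h₂ : IsGeodesic (n := n) γ₂)
    (h : (⟨γ₁ 0, mfderivWithin 𝓘(ℝ, ℝ) (𝓡 n) γ₁ (Icc 0 1) 0 (1 : ℝ)⟩ : TangentBundle (𝓡 n) M) =
      ⟨γ₂ 0, mfderivWithin 𝓘(ℝ, ℝ) (𝓡 n) γ₂ (Icc 0 1) 0 (1 : ℝ)⟩) :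
    EqOn γ₁ γ₂ (Icc 0 1) := by
  let V (γ : ℝ → M) (s : ℝ) : TangentBundle (𝓡 n) M :=
    ⟨γ s, mfderivWithin 𝓘(ℝ, ℝ) (𝓡 n) γ (Icc 0 1) s (1 : ℝ)⟩
  have key : ∀ t ∈ Icc (0 : ℝ) 1, (V γ₁ 0 = V γ₂ 0 ↔ V γ₁ t = V γ₂ t) := by
    intro t ht
    -- Agreement at `s` being equivalent to agreement at `t` is a symmetric and transitive relation,
    -- so on the connected interval it is enough to prove it for nearby times.
    refine isPreconnected_Icc.induction₂ (fun s t ↦ (V γ₁ s = V γ₂ s ↔ V γ₁ t = V γ₂ t))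
      (fun t ht ↦ ?_) (fun _ _ _ _ _ _ h h' ↦ h.trans h') (fun _ _ _ _ h ↦ h.symm)
      (left_mem_Icc.2 zero_le_one) ht
    have hc₁ := h₁.smooth.continuousOn t ht
    have hc₂ := h₂.smooth.continuousOn t ht
    by_cases hγ : γ₁ t = γ₂ t
    swap
    -- Distinct base points stay distinct nearby, as `M` is Hausdorff; both sides of the equivalence
    -- are then false.
    · obtain ⟨A, B, hA, hB, hAt, hBt, hAB⟩ := t2_separation hγ
      filter_upwards [hc₁ (hA.mem_nhds hAt), hc₂ (hB.mem_nhds hBt)] with s hsA hsB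
      refine iff_of_false (fun h ↦ hγ (congrArg TotalSpace.proj h)) fun h ↦ ?_
      have hs : γ₁ s = γ₂ s := congrArg TotalSpace.proj h
      exact disjoint_left.1 hAB (show γ₂ s ∈ A from hs ▸ hsA) hsB
    let e := chartAt (Coord n) (γ₁ t)
    have he : e ∈ IsManifold.maximalAtlas (𝓡 n) ∞ M := IsManifold.chart_mem_maximalAtlas _
    have ht₁ : γ₁ t ∈ e.source := mem_chart_source _ _
    have ht₂ : γ₂ t ∈ e.source := hγ ▸ ht₁
    have hs₁ := hc₁ (e.open_source.mem_nhds ht₁)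
    have hs₂ := hc₂ (e.open_source.mem_nhds ht₂)
    have hfield : ContDiffAt ℝ 1 (geodesicField e) (tangentCoord e (V γ₁ t)) :=
      contDiffAt_geodesicField he (e.map_source ht₁)
    obtain ⟨K, U, hU, hK⟩ := hfield.exists_lipschitzOnWith
    have hode := eventually_eq_iff_of_hasDerivWithinAt (v := fun _ ↦ geodesicField e)
      (f := fun s ↦ tangentCoord e (V γ₁ s)) (g := fun s ↦ tangentCoord e (V γ₂ s)) ht hU
      (Eventually.of_forall fun _ ↦ hK)
      (by
        filter_upwards [self_mem_nhdsWithin, hs₁] with s hs hse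
        exact h₁.hasDerivWithinAt_tangentCoord he hs hse)
      (by
        filter_upwards [self_mem_nhdsWithin, hs₂] with s hs hse
        exact h₂.hasDerivWithinAt_tangentCoord he hs hse)
    filter_upwards [hode, hs₁, hs₂] with s hs hse₁ hse₂
    have hiff {r : ℝ} (hr₁ : γ₁ r ∈ e.source) (hr₂ : γ₂ r ∈ e.source) :
        V γ₁ r = V γ₂ r ↔ tangentCoord e (V γ₁ r) = tangentCoord e (V γ₂ r) :=
      ⟨congrArg _, tangentCoord_injOn he hr₁ hr₂⟩
    rw [hiff ht₁ ht₂, hiff hse₁ hse₂]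
    exact hs
  exact fun t ht ↦ congrArg TotalSpace.proj ((key t ht).1 h)

/-- Two parallel vector fields along a smooth curve which agree at one point agree everywhere. -/
theorem IsParallelAlong.eq_of_eq {γ : ℝ → M} (hγ : ContMDiffOn 𝓘(ℝ, ℝ) (𝓡 n) ∞ γ (Icc 0 1))
    {X Y : ∀ t, TangentSpace (𝓡 n) (γ t)} (hX : IsParallelAlong γ X) (hY : IsParallelAlong γ Y)
    {s t : ℝ} (hs : s ∈ Icc (0 : ℝ) 1) (ht : t ∈ Icc (0 : ℝ) 1) (h : X s = Y s) : X t = Y t := by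
  suffices key : X s = Y s ↔ X t = Y t from key.1 h
  refine isPreconnected_Icc.induction₂ (fun s t ↦ (X s = Y s ↔ X t = Y t))
      (fun t ht ↦ ?_) (fun _ _ _ _ _ _ h h' ↦ h.trans h') (fun _ _ _ _ h ↦ h.symm) hs ht
  let e := chartAt (Coord n) (γ t)
  have he : e ∈ IsManifold.maximalAtlas (𝓡 n) ∞ M := IsManifold.chart_mem_maximalAtlas _
  have hte : γ t ∈ e.source := mem_chart_source _ _
  have hse := (hγ.continuousOn t ht) (e.open_source.mem_nhds hte)
  let C (s : ℝ) (k j : Fin n) : ℝ :=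
    ∑ i, christoffel e (e (γ s)) k i j * derivWithin (fun s ↦ (e (γ s)) i) (Icc 0 1) s
  have hC : ContinuousWithinAt C (Icc 0 1) t := by
    refine continuousWithinAt_pi.2 fun k ↦ continuousWithinAt_pi.2 fun j ↦ ?_
    refine tendsto_finsetSum _ fun i _ ↦ ?_
    refine ContinuousWithinAt.mul ?_ ?_
    · have hΓ := (contDiffOn_christoffel he k i j).continuousOn.continuousAt
        (e.open_target.mem_nhds (e.map_source hte))
      exact ContinuousAt.comp_continuousWithinAt (f := fun s ↦ e (γ s)) hΓ
        ((e.continuousAt hte).comp_continuousWithinAt (hγ.continuousOn t ht))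
    · exact ((contDiffWithinAt_chart_comp he hγ ht hte i).derivWithin
        (uniqueDiffOn_Icc zero_lt_one) (m := 1) (by norm_cast) ht).continuousWithinAt
  -- The linear system is written through the polynomial map `G`, with the coefficients as a
  -- variable. A Lipschitz constant of `G` near `(C t, X t)` then serves all `s` near `t`, by
  -- continuity of `C`.
  let G (p : (Fin n → Fin n → ℝ) × (Fin n → ℝ)) (k : Fin n) : ℝ := -∑ j, p.1 k j * p.2 j
  have hG : ContDiff ℝ 1 G := by
    refine contDiff_pi.2 fun k ↦ (ContDiff.sum fun j _ ↦ ?_).neg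
    fun_prop
  have hcoord {Z : ∀ t, TangentSpace (𝓡 n) (γ t)} (hZ : IsParallelAlong γ Z) :
      ∀ᶠ s in 𝓝[Icc 0 1] t, HasDerivWithinAt (fun s k ↦ components e (Z s) k)
        (G (C s, fun k ↦ components e (Z s) k)) (Icc 0 1) s := by
    filter_upwards [self_mem_nhdsWithin, hse] with s hs hse
    refine hasDerivWithinAt_pi.2 fun k ↦ (hZ s hs e he hse k).congr_deriv ?_
    simp only [G, C, Finset.sum_mul]
    rw [Finset.sum_comm]
  obtain ⟨K, W, hW, hK⟩ := (hG.contDiffAt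
    (x := (C t, fun k ↦ components e (X t) k))).exists_lipschitzOnWith
  obtain ⟨A, hA, U, hU, hAU⟩ := mem_nhds_prod_iff.1 hW
  have hLip : ∀ᶠ s in 𝓝[Icc 0 1] t, LipschitzOnWith K (fun a ↦ G (C s, a)) U := by
    filter_upwards [hC hA] with s hs
    refine LipschitzOnWith.of_dist_le_mul fun a ha b hb ↦ ?_
    refine (hK.dist_le_mul (C s, a) (hAU ⟨hs, ha⟩) (C s, b) (hAU ⟨hs, hb⟩)).trans_eq ?_
    simp
  filter_upwards [eventually_eq_iff_of_hasDerivWithinAt ht hU hLip (hcoord hX) (hcoord hY), hse]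
    with s hs hse
  have hiff {r : ℝ} (hr : γ r ∈ e.source) : X r = Y r ↔
      (fun k ↦ components e (X r) k) = fun k ↦ components e (Y r) k := by
    refine ⟨fun h ↦ by rw [h], fun h ↦ components_injective he hr ?_⟩
    ext k
    exact congrFun h k
  rw [hiff hte, hiff hse]
  exact hs

end Uniqueness

/-! ### Independence of the values of a curve outside `[0,1]`. -/

section Congruence

variable {n : ℕ} {M : Type*} [TopologicalSpace M] [ChartedSpace (Coord n) M]
  [RiemannianBundle (fun x : M ↦ TangentSpace (𝓡 n) x)] {γ γ' : ℝ → M}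

lemma IsParallelAlong.congr {X : ∀ t, TangentSpace (𝓡 n) (γ t)}
    {X' : ∀ t, TangentSpace (𝓡 n) (γ' t)} (hX : IsParallelAlong γ X)
    (h : ∀ t ∈ Icc (0 : ℝ) 1, (⟨γ t, X t⟩ : TangentBundle (𝓡 n) M) = ⟨γ' t, X' t⟩) :
    IsParallelAlong γ' X' := by
  intro t ht e he hte k
  have hγ : EqOn γ γ' (Icc 0 1) := fun s hs ↦ congrArg TotalSpace.proj (h s hs)
  have hc : ∀ s ∈ Icc (0 : ℝ) 1, ∀ j, components e (X' s) j = components e (X s) j := fun s hs j ↦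
    (congrArg (fun p : TangentBundle (𝓡 n) M ↦ components e p.2 j) (h s hs)).symm
  have hd (i : Fin n) : derivWithin (fun s ↦ (e (γ' s)) i) (Icc 0 1) t =
      derivWithin (fun s ↦ (e (γ s)) i) (Icc 0 1) t :=
    derivWithin_congr (fun s hs ↦ by rw [hγ hs]) (by rw [hγ ht])
  rw [← hγ ht] at hte
  have := (hX t ht e he hte k).congr (fun s hs ↦ hc s hs k) (hc t ht k)
  simpa only [hd, hc t ht, hγ ht] using this

lemma IsParallelTransport.congr {x₀ x : M} {v : TangentSpace (𝓡 n) x₀} {w : TangentSpace (𝓡 n) x}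
    (h : IsParallelTransport γ v w) (hγ : EqOn γ γ' (Icc 0 1)) : IsParallelTransport γ' v w := by
  classical
  obtain ⟨X, hX, h0, h1⟩ := h
  -- The fibres over `γ t` and `γ' t` are identified by a cast where the points agree; the value `0`
  -- elsewhere is never used.
  let X' (t : ℝ) : TangentSpace (𝓡 n) (γ' t) := if h : γ t = γ' t then h ▸ X t else 0
  have hX' : ∀ t ∈ Icc (0 : ℝ) 1, (⟨γ t, X t⟩ : TangentBundle (𝓡 n) M) = ⟨γ' t, X' t⟩ := by
    intro t ht
    have hcast : ∀ {p q : M} (h : p = q) (v : TangentSpace (𝓡 n) p),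
        (⟨p, v⟩ : TangentBundle (𝓡 n) M) = ⟨q, h ▸ v⟩ := by
      rintro p _ rfl v
      rfl
    simp only [X', dif_pos (hγ ht)]
    exact hcast _ _
  refine ⟨X', hX.congr hX', ?_, ?_⟩
  · rw [← hX' 0 (by simp), h0]
  · rw [← hX' 1 (by simp), h1]

/-- The chosen vector depends only on the predicate it is chosen from, and the two predicates are
equal; no uniqueness is involved. -/
lemma parallelTransportInv_congr (hγ : EqOn γ γ' (Icc 0 1)) (x₀ x : M)
    (w : TangentSpace (𝓡 n) x) :
    parallelTransportInv γ x₀ x w = parallelTransportInv γ' x₀ x w := by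
  classical
  have h : (fun v : TangentSpace (𝓡 n) x₀ ↦ IsParallelTransport γ v w) =
      fun v ↦ IsParallelTransport γ' v w :=
    funext fun v ↦ propext ⟨fun h ↦ h.congr hγ, fun h ↦ h.congr hγ.symm⟩
  exact congrArg (fun P : TangentSpace (𝓡 n) x₀ → Prop ↦
    if h : ∃ v, P v then h.choose else 0) h

lemma ptcIntegrand_congr (hγ : EqOn γ γ' (Icc 0 1)) (x₀ : M) (δ : ℝ) (k f : M → ℝ) (x : M) :
    ptcIntegrand n x₀ δ k f γ x = ptcIntegrand n x₀ δ k f γ' x := by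
  ext y
  simp only [ptcIntegrand, transportedKernel, parallelTransportInv_congr hγ]

end Congruence

/-! ### Naturality of length, distance, geodesics, parallel transport and `exp`. -/

section Naturality

variable {n : ℕ} {M : Type*} [TopologicalSpace M] [ChartedSpace (Coord n) M]
  {N : Type*} [TopologicalSpace N] [ChartedSpace (Coord n) N]

lemma tangentMap_symm_tangentMap (Φ : M ≃ₘ^∞⟮𝓡 n, 𝓡 n⟯ N) (p : TangentBundle (𝓡 n) M) :
    tangentMap (𝓡 n) (𝓡 n) Φ.symm (tangentMap (𝓡 n) (𝓡 n) Φ p) = p := by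
  have h := tangentMap_comp_at p (diffeomorph_mdifferentiableAt Φ.symm (Φ p.1))
    (diffeomorph_mdifferentiableAt Φ p.1)
  have h' : Φ.symm ∘ Φ = id := funext fun y ↦ Φ.symm_apply_apply y
  rw [← h, h', tangentMap_id]
  rfl

lemma tangentMap_velocity (Φ : M ≃ₘ^∞⟮𝓡 n, 𝓡 n⟯ N) {γ : ℝ → M} {s : Set ℝ} {t : ℝ}
    (hγ : MDifferentiableWithinAt 𝓘(ℝ, ℝ) (𝓡 n) γ s t)
    (hs : UniqueMDiffWithinAt 𝓘(ℝ, ℝ) s t) :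
    mfderivWithin 𝓘(ℝ, ℝ) (𝓡 n) (Φ ∘ γ) s t (1 : ℝ) =
      mfderiv (𝓡 n) (𝓡 n) Φ (γ t) (mfderivWithin 𝓘(ℝ, ℝ) (𝓡 n) γ s t (1 : ℝ)) :=
  DFunLike.congr_fun
    (mfderiv_comp_mfderivWithin t (diffeomorph_mdifferentiableAt Φ (γ t)) hγ hs) (1 : ℝ)

variable [RiemannianBundle (fun x : M ↦ TangentSpace (𝓡 n) x)]
  [RiemannianBundle (fun x : N ↦ TangentSpace (𝓡 n) x)] {Φ : M ≃ₘ^∞⟮𝓡 n, 𝓡 n⟯ N}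

lemma IsRiemannianIsometry.pathELength_comp (hΦ : IsRiemannianIsometry Φ) {γ : ℝ → M}
    (hγ : ContMDiffOn 𝓘(ℝ, ℝ) (𝓡 n) 1 γ (Icc 0 1)) :
    pathELength (𝓡 n) (Φ ∘ γ) 0 1 = pathELength (𝓡 n) γ 0 1 := by
  simp only [pathELength_eq_lintegral_mfderivWithin_Icc]
  refine setLIntegral_congr_fun measurableSet_Icc fun t ht ↦ ?_
  have h := tangentMap_velocity Φ ((hγ t ht).mdifferentiableWithinAt one_ne_zero)
    (uniqueMDiffWithinAt_iff_uniqueDiffWithinAt.2 (uniqueDiffOn_Icc zero_lt_one t ht))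
  exact (congrArg (fun w : TangentSpace (𝓡 n) (Φ (γ t)) ↦ ‖w‖ₑ) h).trans (hΦ.enorm_mfderiv _ _)

/-- The distance is an infimum of lengths, and the image of a nearly optimal curve has the same
length. -/
lemma IsRiemannianIsometry.riemannianEDist_le (hΦ : IsRiemannianIsometry Φ) (x y : M) :
    riemannianEDist (𝓡 n) (Φ x) (Φ y) ≤ riemannianEDist (𝓡 n) x y := by
  refine le_of_forall_gt fun r hr ↦ ?_
  obtain ⟨γ, h0, h1, hγ, hlen⟩ := exists_lt_of_riemannianEDist_lt hr
  rw [← hΦ.pathELength_comp hγ] at hlen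
  refine lt_of_le_of_lt (riemannianEDist_le_pathELength ?_ ?_ ?_ zero_le_one) hlen
  · exact (Φ.contMDiff.of_le (by simp)).comp_contMDiffOn hγ
  · simp [h0]
  · simp [h1]

lemma IsRiemannianIsometry.riemannianEDist_eq (hΦ : IsRiemannianIsometry Φ) (x y : M) :
    riemannianEDist (𝓡 n) (Φ x) (Φ y) = riemannianEDist (𝓡 n) x y := by
  refine le_antisymm (hΦ.riemannianEDist_le x y) ?_
  simpa using hΦ.symm.riemannianEDist_le (Φ x) (Φ y)

variable [IsManifold (𝓡 n) ∞ M] [IsManifold (𝓡 n) ∞ N]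

/-- The equation for `Φ ∘ γ` in `e` is literally the equation for `γ` in the pulled back chart. -/
lemma IsRiemannianIsometry.isGeodesic_comp (hΦ : IsRiemannianIsometry Φ) {γ : ℝ → M}
    (hγ : IsGeodesic (n := n) γ) : IsGeodesic (n := n) (Φ ∘ γ) where
  smooth := Φ.contMDiff.comp_contMDiffOn hγ.smooth
  equation t ht e he hte k := by
    have h := hγ.equation t ht _ (pullbackChart_mem_maximalAtlas Φ he) hte k
    have hΓ := hΦ.christoffel_pullbackChart he (y := e (Φ (γ t))) (e.map_source hte)
    simpa only [pullbackChart_apply, Function.comp_apply, hΓ] using h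

lemma IsRiemannianIsometry.isGeodesicFromTo_comp (hΦ : IsRiemannianIsometry Φ) {x₀ x : M}
    {γ : ℝ → M} (hγ : IsGeodesicFromTo (n := n) x₀ x γ) :
    IsGeodesicFromTo (n := n) (Φ x₀) (Φ x) (Φ ∘ γ) where
  geodesic := hΦ.isGeodesic_comp hγ.geodesic
  source := congrArg Φ hγ.source
  target := congrArg Φ hγ.target

lemma IsRiemannianIsometry.isMinGeodesicFromTo_comp (hΦ : IsRiemannianIsometry Φ) {x₀ x : M}
    {γ : ℝ → M} (hγ : IsMinGeodesicFromTo (n := n) x₀ x γ) :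
    IsMinGeodesicFromTo (n := n) (Φ x₀) (Φ x) (Φ ∘ γ) where
  toIsGeodesicFromTo := hΦ.isGeodesicFromTo_comp hγ.toIsGeodesicFromTo
  minimizing := by
    rw [hΦ.pathELength_comp (hγ.geodesic.smooth.of_le (by simp)), hΦ.riemannianEDist_eq,
      hγ.minimizing]

lemma IsRiemannianIsometry.isParallelAlong_comp (hΦ : IsRiemannianIsometry Φ) {γ : ℝ → M}
    (hγ : ContinuousOn γ (Icc 0 1)) {X : ∀ t, TangentSpace (𝓡 n) (γ t)}
    (hX : IsParallelAlong γ X) :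
    IsParallelAlong (Φ ∘ γ) (fun t ↦ mfderiv (𝓡 n) (𝓡 n) Φ (γ t) (X t)) := by
  intro t ht e he hte k
  have h := hX t ht _ (pullbackChart_mem_maximalAtlas Φ he) hte k
  have hev : ∀ᶠ s in 𝓝[Icc 0 1] t, components e (mfderiv (𝓡 n) (𝓡 n) Φ (γ s) (X s)) k =
      components (pullbackChart Φ e) (X s) k := by
    filter_upwards [hγ t ht ((pullbackChart Φ e).open_source.mem_nhds hte)] with s hs
    rw [components_pullbackChart Φ he hs]
  have h' := h.congr_of_eventuallyEq hev (hev.self_of_nhdsWithin ht)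
  have hΓ := hΦ.christoffel_pullbackChart he (y := e (Φ (γ t))) (e.map_source hte)
  simpa only [pullbackChart_apply, Function.comp_apply, hΓ,
    components_pullbackChart Φ he hte] using h'

lemma IsRiemannianIsometry.isParallelTransport_comp (hΦ : IsRiemannianIsometry Φ) {γ : ℝ → M}
    (hγ : ContinuousOn γ (Icc 0 1)) {x₀ x : M} {v : TangentSpace (𝓡 n) x₀}
    {w : TangentSpace (𝓡 n) x} (h : IsParallelTransport γ v w) :
    IsParallelTransport (Φ ∘ γ) (mfderiv (𝓡 n) (𝓡 n) Φ x₀ v) (mfderiv (𝓡 n) (𝓡 n) Φ x w) := by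
  obtain ⟨X, hX, h0, h1⟩ := h
  exact ⟨_, hΦ.isParallelAlong_comp hγ hX, congrArg (tangentMap (𝓡 n) (𝓡 n) Φ) h0,
    congrArg (tangentMap (𝓡 n) (𝓡 n) Φ) h1⟩

lemma IsRiemannianIsometry.isParallelTransport_comp_iff (hΦ : IsRiemannianIsometry Φ) {γ : ℝ → M}
    (hγ : ContinuousOn γ (Icc 0 1)) {x₀ x : M} (v : TangentSpace (𝓡 n) x₀)
    (w : TangentSpace (𝓡 n) x) :
    IsParallelTransport γ v w ↔
      IsParallelTransport (Φ ∘ γ) (mfderiv (𝓡 n) (𝓡 n) Φ x₀ v) (mfderiv (𝓡 n) (𝓡 n) Φ x w) := by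
  refine ⟨hΦ.isParallelTransport_comp hγ, fun h ↦ ?_⟩
  have h' := (hΦ.symm.isParallelTransport_comp (Φ.continuous.comp_continuousOn hγ) h).congr
    (γ' := γ) fun t _ ↦ Φ.symm_apply_apply (γ t)
  obtain ⟨X, hX, h0, h1⟩ := h'
  exact ⟨X, hX, h0.trans (tangentMap_symm_tangentMap Φ ⟨x₀, v⟩),
    h1.trans (tangentMap_symm_tangentMap Φ ⟨x, w⟩)⟩

lemma IsRiemannianIsometry.isGeodesicWith_comp (hΦ : IsRiemannianIsometry Φ) {x : M}
    {v : TangentSpace (𝓡 n) x} {γ : ℝ → M} (hγ : IsGeodesicWith x v γ) :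
    IsGeodesicWith (Φ x) (mfderiv (𝓡 n) (𝓡 n) Φ x v) (Φ ∘ γ) := by
  refine ⟨hΦ.isGeodesic_comp hγ.1, ?_⟩
  have h0 : (0 : ℝ) ∈ Icc (0 : ℝ) 1 := by simp
  have h := tangentMap_velocity Φ ((hγ.1.smooth 0 h0).mdifferentiableWithinAt (by simp))
    (uniqueMDiffWithinAt_iff_uniqueDiffWithinAt.2 (uniqueDiffOn_Icc zero_lt_one 0 h0))
  refine Eq.trans ?_ (congrArg (tangentMap (𝓡 n) (𝓡 n) Φ) hγ.2)
  exact congrArg (TotalSpace.mk (Φ (γ 0))) h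

lemma IsRiemannianIsometry.exists_isGeodesicWith_iff (hΦ : IsRiemannianIsometry Φ) (x : M)
    (v : TangentSpace (𝓡 n) x) :
    (∃ γ : ℝ → N, IsGeodesicWith (Φ x) (mfderiv (𝓡 n) (𝓡 n) Φ x v) γ) ↔
      ∃ γ : ℝ → M, IsGeodesicWith x v γ := by
  refine ⟨fun ⟨γ, hγ⟩ ↦ ⟨Φ.symm ∘ γ, ?_⟩, fun ⟨γ, hγ⟩ ↦ ⟨Φ ∘ γ, hΦ.isGeodesicWith_comp hγ⟩⟩
  obtain ⟨h1, h2⟩ := hΦ.symm.isGeodesicWith_comp hγ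
  exact ⟨h1, h2.trans (tangentMap_symm_tangentMap Φ ⟨x, v⟩)⟩

lemma expMap_eq [T2Space M]
    [IsContMDiffRiemannianBundle (𝓡 n) ∞ (Coord n) (fun x : M ↦ TangentSpace (𝓡 n) x)]
    {x : M} {v : TangentSpace (𝓡 n) x} {γ : ℝ → M} (hγ : IsGeodesicWith x v γ) :
    expMap x v = γ 1 := by
  have h : ∃ γ : ℝ → M, IsGeodesicWith x v γ := ⟨γ, hγ⟩
  rw [expMap, dif_pos h]
  exact h.choose_spec.1.eqOn hγ.1 (h.choose_spec.2.trans hγ.2.symm) (by simp)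

/-- Two parallel fields that agree at time `1` agree at time `0`. -/
lemma parallelTransportInv_eq
    [IsContMDiffRiemannianBundle (𝓡 n) ∞ (Coord n) (fun x : M ↦ TangentSpace (𝓡 n) x)]
    {γ : ℝ → M} (hγ : ContMDiffOn 𝓘(ℝ, ℝ) (𝓡 n) ∞ γ (Icc 0 1)) {x₀ x : M}
    {v : TangentSpace (𝓡 n) x₀} {w : TangentSpace (𝓡 n) x} (h : IsParallelTransport γ v w) :
    parallelTransportInv γ x₀ x w = v := by
  have hex : ∃ v : TangentSpace (𝓡 n) x₀, IsParallelTransport γ v w := ⟨v, h⟩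
  rw [parallelTransportInv, dif_pos hex]
  obtain ⟨X, hX, hX0, hX1⟩ := hex.choose_spec
  obtain ⟨Y, hY, hY0, hY1⟩ := h
  have h1 : X 1 = Y 1 := TotalSpace.mk_injective (γ 1) (hX1.trans hY1.symm)
  have h0 : X 0 = Y 0 := hX.eq_of_eq hγ hY (by simp) (by simp) h1
  exact TotalSpace.mk_injective x₀ (hX0.symm.trans ((congrArg (TotalSpace.mk (γ 0)) h0).trans hY0))

variable
  [IsContMDiffRiemannianBundle (𝓡 n) ∞ (Coord n) (fun x : M ↦ TangentSpace (𝓡 n) x)]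
  [IsContMDiffRiemannianBundle (𝓡 n) ∞ (Coord n) (fun x : N ↦ TangentSpace (𝓡 n) x)]

lemma IsRiemannianIsometry.parallelTransportInv_comp (hΦ : IsRiemannianIsometry Φ) {γ : ℝ → M}
    (hγ : ContMDiffOn 𝓘(ℝ, ℝ) (𝓡 n) ∞ γ (Icc 0 1)) (x₀ x : M) (w : TangentSpace (𝓡 n) x) :
    parallelTransportInv (Φ ∘ γ) (Φ x₀) (Φ x) (mfderiv (𝓡 n) (𝓡 n) Φ x w) =
      mfderiv (𝓡 n) (𝓡 n) Φ x₀ (parallelTransportInv γ x₀ x w) := by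
  by_cases h : ∃ v : TangentSpace (𝓡 n) x₀, IsParallelTransport γ v w
  · obtain ⟨v, hv⟩ := h
    rw [parallelTransportInv_eq hγ hv]
    exact parallelTransportInv_eq (Φ.contMDiff.comp_contMDiffOn hγ)
      (hΦ.isParallelTransport_comp hγ.continuousOn hv)
  -- If no `v` exists for `γ`, none exists for `Φ ∘ γ`; both values are `0`, which `dΦ` preserves.
  · have h' : ¬ ∃ v : TangentSpace (𝓡 n) (Φ x₀),
        IsParallelTransport (Φ ∘ γ) v (mfderiv (𝓡 n) (𝓡 n) Φ x w) := by
      rintro ⟨v, hv⟩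
      rw [← mfderiv_apply_mfderiv_symm Φ x₀ v] at hv
      exact h ⟨_, (hΦ.isParallelTransport_comp_iff hγ.continuousOn _ w).2 hv⟩
    rw [parallelTransportInv, dif_neg h', parallelTransportInv, dif_neg h]
    exact (map_zero (mfderiv (𝓡 n) (𝓡 n) Φ x₀)).symm

variable [T2Space M] [T2Space N]

lemma IsRiemannianIsometry.expMap_mfderiv (hΦ : IsRiemannianIsometry Φ) (x : M)
    (v : TangentSpace (𝓡 n) x) :
    expMap (Φ x) (mfderiv (𝓡 n) (𝓡 n) Φ x v) = Φ (expMap x v) := by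
  by_cases h : ∃ γ : ℝ → M, IsGeodesicWith x v γ
  · obtain ⟨γ, hγ⟩ := h
    rw [expMap_eq hγ, expMap_eq (hΦ.isGeodesicWith_comp hγ)]
    rfl
  · rw [expMap, dif_neg (mt (hΦ.exists_isGeodesicWith_iff x v).1 h), expMap, dif_neg h]

end Naturality

/-! ### Injectivity radius, logarithm and the convolution. -/

section Invariance

variable {n : ℕ} {M : Type*} [TopologicalSpace M] [ChartedSpace (Coord n) M]
  [RiemannianBundle (fun x : M ↦ TangentSpace (𝓡 n) x)]
  {N : Type*} [TopologicalSpace N] [ChartedSpace (Coord n) N]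
  [RiemannianBundle (fun x : N ↦ TangentSpace (𝓡 n) x)] {Φ : M ≃ₘ^∞⟮𝓡 n, 𝓡 n⟯ N}

/-- The strict inequality leaves room for an admissible `r > δ`, whose open ball contains the closed
`δ`-ball. -/
lemma expMap_injOn_of_lt_injectivityRadius {δ : ℝ}
    (hδ : ENNReal.ofReal δ < injectivityRadius n M) (x : M) :
    InjOn (expMap (n := n) x) {v | ‖v‖ ≤ δ} := by
  obtain ⟨r, ⟨-, hr, -⟩, hlt⟩ := lt_sSup_iff.1 (hδ.trans_le (iInf_le _ x))
  refine hr.mono fun v (hv : ‖v‖ ≤ δ) ↦ ?_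
  change ‖v‖ₑ < r
  rw [← ofReal_norm]
  exact (ENNReal.ofReal_le_ofReal hv).trans_lt hlt

lemma logMap_eq {δ : ℝ} (hδ : ENNReal.ofReal δ < injectivityRadius n M) {x : M}
    {v : TangentSpace (𝓡 n) x} (hv : ‖v‖ ≤ δ) : logMap δ x (expMap x v) = v := by
  have h : ∃ u : TangentSpace (𝓡 n) x, ‖u‖ ≤ δ ∧ expMap x u = expMap x v := ⟨v, hv, rfl⟩
  rw [logMap, dif_pos h]
  exact expMap_injOn_of_lt_injectivityRadius hδ x h.choose_spec.1 hv h.choose_spec.2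

variable [IsManifold (𝓡 n) ∞ M] [IsManifold (𝓡 n) ∞ N] [T2Space M] [T2Space N]
  [IsContMDiffRiemannianBundle (𝓡 n) ∞ (Coord n) (fun x : M ↦ TangentSpace (𝓡 n) x)]
  [IsContMDiffRiemannianBundle (𝓡 n) ∞ (Coord n) (fun x : N ↦ TangentSpace (𝓡 n) x)]

lemma IsRiemannianIsometry.injectivityRadiusAt_le (hΦ : IsRiemannianIsometry Φ) (x : M) :
    injectivityRadiusAt n x ≤ injectivityRadiusAt n (Φ x) := by
  refine sSup_le_sSup fun r ⟨hex, hinj, hloc⟩ ↦ ?_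
  let L : TangentSpace (𝓡 n) (Φ x) ≃L[ℝ] TangentSpace (𝓡 n) x :=
    (Φ.mfderivToContinuousLinearEquiv (by simp) x).symm
  have hL (w : TangentSpace (𝓡 n) (Φ x)) : mfderiv (𝓡 n) (𝓡 n) Φ x (L w) = w :=
    (Φ.mfderivToContinuousLinearEquiv (by simp) x).apply_symm_apply w
  have hnorm (w : TangentSpace (𝓡 n) (Φ x)) : ‖L w‖ₑ = ‖w‖ₑ := by
    conv_rhs => rw [← hL w, hΦ.enorm_mfderiv]
  -- In this form, with `L` a linear isometry and `Φ` a diffeomorphism, each condition defining the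
  -- radius passes from `x` to `Φ x`.
  have hexp : expMap (n := n) (Φ x) = Φ ∘ expMap (n := n) x ∘ L := by
    ext1 w
    conv_lhs => rw [← hL w, hΦ.expMap_mfderiv]
    rfl
  refine ⟨fun w hw ↦ ?_, ?_, ?_⟩
  · rw [← hL w, hΦ.exists_isGeodesicWith_iff]
    exact hex _ ((hnorm w).trans_lt hw)
  · rw [hexp]
    exact Φ.injective.comp_injOn (hinj.comp L.injective.injOn fun w hw ↦ (hnorm w).trans_lt hw)
  · rw [hexp]
    rintro ⟨w, hw⟩
    have h1 : IsLocalDiffeomorphAt 𝓘(ℝ, TangentSpace (𝓡 n) (Φ x)) 𝓘(ℝ, TangentSpace (𝓡 n) x) ∞ L w :=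
      L.toDiffeomorph.isLocalDiffeomorph w
    have h2 : IsLocalDiffeomorphAt 𝓘(ℝ, TangentSpace (𝓡 n) x) (𝓡 n) ∞ (expMap (n := n) x) (L w) :=
      hloc ⟨L w, (hnorm w).trans_lt hw⟩
    exact (h1.comp _ _ h2).comp _ _ (Φ.isLocalDiffeomorph _)

lemma IsRiemannianIsometry.injectivityRadius_le (hΦ : IsRiemannianIsometry Φ) :
    injectivityRadius n M ≤ injectivityRadius n N := by
  refine le_iInf fun y ↦ ?_
  obtain ⟨x, rfl⟩ := Φ.surjective y
  exact (iInf_le _ x).trans (hΦ.injectivityRadiusAt_le x)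

lemma IsRiemannianIsometry.isKernel_comp (hΦ : IsRiemannianIsometry Φ) {x₀ : M} {δ : ℝ}
    {k : M → ℝ} (hk : IsKernel n x₀ δ k) : IsKernel n (Φ x₀) δ (k ∘ Φ.symm) where
  pos := hk.pos
  lt_injectivityRadius := hk.lt_injectivityRadius.trans_le hΦ.injectivityRadius_le
  support y hy := by
    obtain ⟨x, rfl⟩ := Φ.surjective y
    change ENNReal.ofReal δ < riemannianEDist (𝓡 n) (Φ x₀) (Φ x) at hy
    rw [hΦ.riemannianEDist_eq] at hy
    simpa using hk.support x hy

lemma IsRiemannianIsometry.logMap_comp (hΦ : IsRiemannianIsometry Φ) {δ : ℝ}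
    (hδ : ENNReal.ofReal δ < injectivityRadius n M) (x y : M) :
    logMap δ (Φ x) (Φ y) = mfderiv (𝓡 n) (𝓡 n) Φ x (logMap δ x y) := by
  by_cases h : ∃ v : TangentSpace (𝓡 n) x, ‖v‖ ≤ δ ∧ expMap x v = y
  · obtain ⟨v, hv, rfl⟩ := h
    rw [logMap_eq hδ hv, ← hΦ.expMap_mfderiv]
    exact logMap_eq (hδ.trans_le hΦ.injectivityRadius_le) ((hΦ.norm_mfderiv x v).trans_le hv)
  · have h' : ¬ ∃ w : TangentSpace (𝓡 n) (Φ x), ‖w‖ ≤ δ ∧ expMap (Φ x) w = Φ y := by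
      rintro ⟨w, hw, hwy⟩
      let v : TangentSpace (𝓡 n) x := mfderiv (𝓡 n) (𝓡 n) Φ.symm (Φ x) w
      have hv : mfderiv (𝓡 n) (𝓡 n) Φ x v = w := mfderiv_apply_mfderiv_symm Φ x w
      rw [← hv, hΦ.expMap_mfderiv] at hwy
      rw [← hv, hΦ.norm_mfderiv] at hw
      exact h ⟨v, hw, Φ.injective hwy⟩
    rw [logMap, dif_neg h', logMap, dif_neg h]
    exact (map_zero (mfderiv (𝓡 n) (𝓡 n) Φ x)).symm

lemma IsRiemannianIsometry.ptcIntegrand_comp (hΦ : IsRiemannianIsometry Φ) {δ : ℝ}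
    (hδ : ENNReal.ofReal δ < injectivityRadius n M) {γ : ℝ → M}
    (hγ : ContMDiffOn 𝓘(ℝ, ℝ) (𝓡 n) ∞ γ (Icc 0 1)) (x₀ : M) (k f : M → ℝ) (x : M) :
    ptcIntegrand n (Φ x₀) δ (k ∘ Φ.symm) (f ∘ Φ.symm) (Φ ∘ γ) (Φ x) ∘ Φ =
      ptcIntegrand n x₀ δ k f γ x := by
  ext y
  simp only [Function.comp_apply, ptcIntegrand, transportedKernel, hΦ.riemannianEDist_eq,
    hΦ.logMap_comp hδ, hΦ.parallelTransportInv_comp hγ, hΦ.expMap_mfderiv,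
    Diffeomorph.symm_apply_apply]

variable [MeasurableSpace M] [BorelSpace M] [MeasurableSpace N] [BorelSpace N]

lemma IsRiemannianIsometry.integrable_ptcIntegrand_comp_iff (hΦ : IsRiemannianIsometry Φ) {δ : ℝ}
    (hδ : ENNReal.ofReal δ < injectivityRadius n M) {γ : ℝ → M}
    (hγ : ContMDiffOn 𝓘(ℝ, ℝ) (𝓡 n) ∞ γ (Icc 0 1)) (x₀ : M) (k f : M → ℝ) (x : M) :
    Integrable (ptcIntegrand n (Φ x₀) δ (k ∘ Φ.symm) (f ∘ Φ.symm) (Φ ∘ γ) (Φ x))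
        (riemannianVolume n N) ↔
      Integrable (ptcIntegrand n x₀ δ k f γ x) (riemannianVolume n M) := by
  rw [← hΦ.map_riemannianVolume, ← hΦ.ptcIntegrand_comp hδ hγ]
  exact Φ.toHomeomorph.measurableEmbedding.integrable_map_iff

/-- Parallel transport convolution is invariant under isometries. -/
theorem IsRiemannianIsometry.ptConvolution_comp (hΦ : IsRiemannianIsometry Φ) {δ : ℝ}
    (hδ : ENNReal.ofReal δ < injectivityRadius n M) {γ : ℝ → M}
    (hγ : ContMDiffOn 𝓘(ℝ, ℝ) (𝓡 n) ∞ γ (Icc 0 1)) (x₀ : M) (k f : M → ℝ) (x : M) :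
    ptConvolution n (Φ x₀) δ (k ∘ Φ.symm) (f ∘ Φ.symm) (Φ ∘ γ) (Φ x) =
      ptConvolution n x₀ δ k f γ x := by
  simp only [ptConvolution]
  rw [← hΦ.map_riemannianVolume, ← hΦ.ptcIntegrand_comp hδ hγ]
  exact Φ.toHomeomorph.measurableEmbedding.integral_map _

end Invariance

end PTC

end

/-! ### The main theorem. -/

theorem mainTheorem7 {n : ℕ} {M N : Type*}
    [TopologicalSpace M] [T2Space M] [SecondCountableTopology M]
    [ChartedSpace (PTC.Coord n) M] [IsManifold (𝓡 n) ∞ M]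
    [RiemannianBundle (fun x : M ↦ TangentSpace (𝓡 n) x)]
    [IsContMDiffRiemannianBundle (𝓡 n) ∞ (PTC.Coord n) (fun x : M ↦ TangentSpace (𝓡 n) x)]
    [MeasurableSpace M] [BorelSpace M]
    [TopologicalSpace N] [T2Space N] [SecondCountableTopology N]
    [ChartedSpace (PTC.Coord n) N] [IsManifold (𝓡 n) ∞ N]
    [RiemannianBundle (fun x : N ↦ TangentSpace (𝓡 n) x)]
    [IsContMDiffRiemannianBundle (𝓡 n) ∞ (PTC.Coord n) (fun x : N ↦ TangentSpace (𝓡 n) x)]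
    [MeasurableSpace N] [BorelSpace N]
    (Φ : M ≃ₘ^∞⟮𝓡 n, 𝓡 n⟯ N) (hΦ : PTC.IsRiemannianIsometry Φ)
    (x₀ : M) (δ : ℝ) (k : M → ℝ) (hk : PTC.IsKernel n x₀ δ k) (f : M → ℝ) :
    -- the transplanted kernel is a kernel on `N` centred at `Φ x₀`, with the same radius
    PTC.IsKernel n (Φ x₀) δ (k ∘ Φ.symm) ∧
    -- the volume measure is preserved
    (PTC.riemannianVolume n M).map Φ = PTC.riemannianVolume n N ∧
    -- for every `x` and every geodesic `γ` from `x₀` to `x`: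
    (∀ (x : M) (γ : ℝ → M), PTC.IsGeodesicFromTo (n := n) x₀ x γ →
      PTC.IsGeodesicFromTo (n := n) (Φ x₀) (Φ x) (Φ ∘ γ) ∧
      (PTC.IsMinGeodesicFromTo (n := n) x₀ x γ →
        PTC.IsMinGeodesicFromTo (n := n) (Φ x₀) (Φ x) (Φ ∘ γ)) ∧
      (∀ (v : TangentSpace (𝓡 n) x₀) (w : TangentSpace (𝓡 n) x),
        PTC.IsParallelTransport γ v w ↔
          PTC.IsParallelTransport (Φ ∘ γ)
            (mfderiv (𝓡 n) (𝓡 n) Φ x₀ v) (mfderiv (𝓡 n) (𝓡 n) Φ x w)) ∧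
      (Integrable (PTC.ptcIntegrand n (Φ x₀) δ (k ∘ Φ.symm) (f ∘ Φ.symm) (Φ ∘ γ) (Φ x))
          (PTC.riemannianVolume n N) ↔
        Integrable (PTC.ptcIntegrand n x₀ δ k f γ x) (PTC.riemannianVolume n M)) ∧
      PTC.ptConvolution n (Φ x₀) δ (k ∘ Φ.symm) (f ∘ Φ.symm) (Φ ∘ γ) (Φ x) =
        PTC.ptConvolution n x₀ δ k f γ x) ∧
    -- if the minimizing geodesic from `x₀` to `x` is unique, then the convolution at `x` and at
    -- `Φ x`, taken along any minimizing geodesics, coincide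
    (∀ (x : M) (γ : ℝ → M) (γ' : ℝ → N), PTC.IsMinGeodesicFromTo (n := n) x₀ x γ →
      (∀ γ₁ : ℝ → M, PTC.IsMinGeodesicFromTo (n := n) x₀ x γ₁ → EqOn γ₁ γ (Icc 0 1)) →
      PTC.IsMinGeodesicFromTo (n := n) (Φ x₀) (Φ x) γ' →
      PTC.ptConvolution n (Φ x₀) δ (k ∘ Φ.symm) (f ∘ Φ.symm) γ' (Φ x) =
        PTC.ptConvolution n x₀ δ k f γ x) := by
  have hδ := hk.lt_injectivityRadius
  refine ⟨hΦ.isKernel_comp hk, hΦ.map_riemannianVolume, fun x γ hγ ↦ ⟨hΦ.isGeodesicFromTo_comp hγ,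
    hΦ.isMinGeodesicFromTo_comp, hΦ.isParallelTransport_comp_iff hγ.geodesic.smooth.continuousOn,
    hΦ.integrable_ptcIntegrand_comp_iff hδ hγ.geodesic.smooth x₀ k f x,
    hΦ.ptConvolution_comp hδ hγ.geodesic.smooth x₀ k f x⟩, fun x γ γ' hγ huniq hγ' ↦ ?_⟩
  -- Pulled back by `Φ.symm`, `γ'` is a minimizing geodesic from `x₀` to `x`, hence equals `γ` on
  -- `[0,1]`.
  have hmin := hΦ.symm.isMinGeodesicFromTo_comp hγ'
  rw [Φ.symm_apply_apply, Φ.symm_apply_apply] at hmin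
  have heq : EqOn γ' (Φ ∘ γ) (Icc 0 1) := fun t ht ↦ by
    rw [Function.comp_apply, ← huniq _ hmin ht]
    exact (Φ.apply_symm_apply (γ' t)).symm
  rw [← hΦ.ptConvolution_comp hδ hγ.geodesic.smooth x₀ k f x, PTC.ptConvolution,
    PTC.ptcIntegrand_congr heq]
  rfl
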